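/- Let $n\ge 2$ and, for $0<\delta<\frac{\pi}{2}$, let $B(\delta)$ be a closed geodesic ball of radius $\delta$ in the unit sphere $\mathbb S^n$ with its standard metric. Let $\mu(\delta)$ be the first nonzero Neumann eigenvalue of $B(\delta)$, i.e. the least number $m\neq 0$ for which there is a function $u\not\equiv 0$ on $B(\delta)$, smooth up to the boundary, with $-\Delta u=m\,u$ in the interior and vanishing normal derivative on $\partial B(\delta)$. Put $$\tilde\mu(\delta)=n+\frac{(\sin\delta)^{n-2}\cos\delta}{\int_0^\delta(\sin t)^{n-1}\,dt},$$ and for a function $\nu$ on $(0,\frac\pi2)$ put $$F_\nu(\delta)=\left[1-\left(1-\frac{n}{2\nu(\delta)}\right)\cos\delta\right]^{-1}\frac{n+1}{8n}+\frac{(n+3)\cos^2\delta-4}{4\sin^2\delta}.$$ Let $\delta_0\in(0,\frac{\pi}{2})$ be a zero of $F=F_\mu$. Then: (i) the function $F_{\tilde\mu}$ has exactly one zero $\tilde\delta_0$ in $(0,\frac{\pi}{2})$, and $\delta_0>\tilde\delta_0$; (ii) the equation $n(n+3)x^4+n(n+3)x^3+2n(n+1)x^2+(1-3n)x-7n+1=0$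 has exactly one root $\tilde\kappa$ in $(0,1)$, and $\cos\delta_0<\tilde\kappa$; (iii) $\displaystyle \cos^2\delta_0<\frac{7n-1}{2n^2+5n-1}$. -/

import Mathlib

open Set
open scoped ContDiff InnerProductSpace

noncomputable section

namespace SphereBall

/-- The ambient Euclidean space `ℝⁿ⁺¹` of the round sphere `𝕊ⁿ = Metric.sphere 0 1`. -/
abbrev Ambient (n : ℕ) : Type := EuclideanSpace ℝ (Fin (n + 1))

/-- The closed geodesic ball `B(δ)` of radius `δ` about `p` in the unit sphere; the geodesic
distance of two points of the unit sphere is the angle between them. -/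
def geodesicBall {n : ℕ} (p : Metric.sphere (0 : Ambient n) 1) (δ : ℝ) : Set (Ambient n) :=
  {x | x ∈ Metric.sphere (0 : Ambient n) 1 ∧ InnerProductGeometry.angle (p : Ambient n) x ≤ δ}

/-- The Laplace-Beltrami operator of the round unit sphere: the Euclidean Laplacian, at a point of
the sphere, of the extension `y ↦ u (y / ‖y‖)` that is constant along rays. -/
def sphereLaplacian {n : ℕ} (u : Ambient n → ℝ) (x : Ambient n) : ℝ :=
  Laplacian.laplacian (fun y : Ambient n => u (‖y‖⁻¹ • y)) x

/-- The outward unit normal of `B(δ)` at a boundary point `x = cos δ p + sin δ e` (with `e` a unit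
vector orthogonal to `p`): it is `- sin δ p + cos δ e = (cos δ x - p) / sin δ`. -/
def outwardNormal {n : ℕ} (p : Metric.sphere (0 : Ambient n) 1) (δ : ℝ) (x : Ambient n) :
    Ambient n :=
  (Real.sin δ)⁻¹ • (Real.cos δ • x - (p : Ambient n))

/-- `m` is a Neumann eigenvalue of `B(δ)`: there is a function `u`, smooth on `B(δ)` up to the
boundary and not identically zero there, with `-Δu = m u` in the interior and vanishing normal
derivative on the boundary. Only the values of `u` on `B(δ)` matter; smoothness up to the boundary
is expressed by smoothness on an open neighbourhood in the ambient space. -/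
def IsNeumannEigenvalue {n : ℕ} (p : Metric.sphere (0 : Ambient n) 1) (δ m : ℝ) : Prop :=
  ∃ u : Ambient n → ℝ,
    (∃ U : Set (Ambient n), IsOpen U ∧ geodesicBall p δ ⊆ U ∧ ContDiffOn ℝ ∞ u U) ∧
    (∃ x ∈ geodesicBall p δ, u x ≠ 0) ∧
    (∀ x ∈ Metric.sphere (0 : Ambient n) 1,
      InnerProductGeometry.angle (p : Ambient n) x < δ → -sphereLaplacian u x = m * u x) ∧
    (∀ x ∈ Metric.sphere (0 : Ambient n) 1,
      InnerProductGeometry.angle (p : Ambient n) x = δ →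
        fderiv ℝ u x (outwardNormal p δ x) = 0)

/-- `m` is the first nonzero Neumann eigenvalue of `B(δ)`, i.e. the least nonzero one. -/
def IsFirstNonzeroNeumannEigenvalue {n : ℕ} (p : Metric.sphere (0 : Ambient n) 1) (δ m : ℝ) :
    Prop :=
  IsLeast {l : ℝ | l ≠ 0 ∧ IsNeumannEigenvalue p δ l} m

open Classical in
/-- `μ(δ)`, the first nonzero Neumann eigenvalue of `B(δ)`. The default value `0` is for radii
without such an eigenvalue; it plays no role for `0 < δ < π`, where there is always one. -/
def neumannMu {n : ℕ} (p : Metric.sphere (0 : Ambient n) 1) (δ : ℝ) : ℝ :=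
  if h : ∃ m, IsFirstNonzeroNeumannEigenvalue p δ m then h.choose else 0

theorem neumannMu_eq {n : ℕ} {p : Metric.sphere (0 : Ambient n) 1} {δ m : ℝ}
    (h : IsFirstNonzeroNeumannEigenvalue p δ m) : neumannMu p δ = m := by
  have hex : ∃ m, IsFirstNonzeroNeumannEigenvalue p δ m := ⟨m, h⟩
  rw [neumannMu, dif_pos hex]
  exact IsLeast.unique hex.choose_spec h

/-- `μ̃(δ) = n + sinⁿ⁻² δ cos δ / ∫₀^δ sinⁿ⁻¹ t dt` (used for `n ≥ 2`). -/
def muTilde (n : ℕ) (δ : ℝ) : ℝ :=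
  n + Real.sin δ ^ (n - 2) * Real.cos δ / ∫ t in (0 : ℝ)..δ, Real.sin t ^ (n - 1)

/-- `α(δ) = [1 - (1 - n / (2 μ(δ))) cos δ]⁻¹ (n + 1) / (8 n)`, for a given function `μ`. -/
def alpha (n : ℕ) (μ : ℝ → ℝ) (δ : ℝ) : ℝ :=
  (1 - (1 - n / (2 * μ δ)) * Real.cos δ)⁻¹ * ((n + 1) / (8 * n))

/-- `F(δ) = α(δ) + ((n + 3) cos² δ - 4) / (4 sin² δ)`, for a given function `μ`. -/
def thresholdFun (n : ℕ) (μ : ℝ → ℝ) (δ : ℝ) : ℝ :=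
  alpha n μ δ + ((n + 3) * Real.cos δ ^ 2 - 4) / (4 * Real.sin δ ^ 2)

/-- The quartic `n(n+3)x⁴ + n(n+3)x³ + 2n(n+1)x² + (1-3n)x - 7n + 1`. -/
def quartic (n : ℕ) (x : ℝ) : ℝ :=
  n * (n + 3) * x ^ 4 + n * (n + 3) * x ^ 3 + 2 * n * (n + 1) * x ^ 2 + (1 - 3 * n) * x - 7 * n + 1

end SphereBall

end

/-! The heart is the strict bound `muTilde n δ < m` for every nonzero Neumann eigenvalue m of B(δ)
(`muTilde_lt_of_isNeumannEigenvalue`). The remaining claims are one-variable analysis.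

For the bound, no spectral theory is used. An eigenfunction is continued near the ball as a function
constant along rays, and is integrated over the geodesic spheres about p against powers ⟪a, ξ⟫ ^ k
of linear forms. Powers determine a continuous function on the equator, so some moment is nonzero.
Take k minimal. The angular Laplacian, a sum of squares of infinitesimal rotations, is symmetric,
and it sends ⟪a, ξ⟫ ^ k to -k(k+n-2)⟪a, ξ⟫ ^ k plus a multiple of the power k-2, whose moment
vanishes. Hence the moment g(r) solves the radial equation with λ = k(k+n-2) and g'(δ) = 0
(`sphereMoment_ode`). If k ≥ 1, then λ ≥ n-1. If k = 0, then g' solves the equation with λ = n-1 and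
vanishes at δ.

The radial equation is compared with its solution sin t for m = n, λ = n-1
(`muTilde_lt_of_monotone_piece`). At a positive maximum r of ±g this gives m > μ̃(r), and μ̃(r) ≥
μ̃(δ) because μ̃ is decreasing.

A larger μ makes the bracket in F smaller, so F_μ(δ₀) = 0 forces F_μ̃(δ₀) < 0. Up to a positive
factor, F_μ̃ is a positive constant minus βT, with β > 0 strictly increasing and T increasing. So it
changes sign once, which gives (i). Inserting μ̃ sin² > n turns F_μ̃(δ₀) < 0 into negativity of the
quartic at cos δ₀ (`quartic_cos_neg`). Since quartic(x)/x is increasing, (ii) follows, and a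
splitting of the quartic gives (iii). -/

namespace SphereBall

open MeasureTheory

/-! ### The volume integral and monotonicity of μ̃ -/

/-- The volume `∫₀^δ sinⁿ⁻¹ t dt` of the geodesic ball of radius `δ`, up to a constant factor. -/
noncomputable def sinPowIntegral (n : ℕ) (δ : ℝ) : ℝ := ∫ t in (0 : ℝ)..δ, Real.sin t ^ (n - 1)

theorem hasDerivAt_sinPowIntegral (n : ℕ) (δ : ℝ) :
    HasDerivAt (sinPowIntegral n) (Real.sin δ ^ (n - 1)) δ := by
  have hc : Continuous fun t : ℝ => Real.sin t ^ (n - 1) := Real.continuous_sin.pow _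
  exact intervalIntegral.integral_hasDerivAt_right (hc.intervalIntegrable _ _)
    (hc.stronglyMeasurableAtFilter _ _) hc.continuousAt

theorem sinPowIntegral_zero (n : ℕ) : sinPowIntegral n 0 = 0 := by
  simp [sinPowIntegral]

theorem sinPowIntegral_pos (n : ℕ) {δ : ℝ} (h0 : 0 < δ) (h1 : δ < Real.pi) :
    0 < sinPowIntegral n δ := by
  refine intervalIntegral.intervalIntegral_pos_of_pos_on
    ((Real.continuous_sin.pow _).intervalIntegrable _ _) (fun x hx => ?_) h0
  exact pow_pos (Real.sin_pos_of_pos_of_lt_pi hx.1 (hx.2.trans h1)) _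

theorem sinPowIntegral_nonneg (n : ℕ) {δ : ℝ} (h0 : 0 ≤ δ) (h1 : δ < Real.pi) :
    0 ≤ sinPowIntegral n δ := by
  rcases h0.eq_or_lt with rfl | h
  · rw [sinPowIntegral_zero]
  · exact (sinPowIntegral_pos n h h1).le

/-- The difference of the two sides vanishes at 0, and its derivative is n sin t times the integral,
because the terms n sinⁿ⁻¹ t cos t cancel. -/
theorem mul_cos_mul_sinPowIntegral_lt {n : ℕ} (hn : 1 ≤ n) {δ : ℝ} (h0 : 0 < δ)
    (h1 : δ < Real.pi) : n * Real.cos δ * sinPowIntegral n δ < Real.sin δ ^ n := by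
  have hd : ∀ t : ℝ, HasDerivAt
      (fun t => Real.sin t ^ n - n * Real.cos t * sinPowIntegral n t)
      (n * Real.sin t * sinPowIntegral n t) t := by
    intro t
    have h := ((Real.hasDerivAt_sin t).pow n).sub
      (((Real.hasDerivAt_cos t).const_mul (n : ℝ)).mul (hasDerivAt_sinPowIntegral n t))
    refine h.congr_deriv ?_
    ring
  have hmono : StrictMonoOn
      (fun t => Real.sin t ^ n - n * Real.cos t * sinPowIntegral n t) (Icc 0 δ) := by
    refine strictMonoOn_of_deriv_pos (convex_Icc _ _)
      (fun t _ => (hd t).continuousAt.continuousWithinAt) (fun t ht => ?_)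
    rw [interior_Icc] at ht
    rw [(hd t).deriv]
    have hn' : (0 : ℝ) < n := by exact_mod_cast hn
    exact mul_pos (mul_pos hn' (Real.sin_pos_of_pos_of_lt_pi ht.1 (ht.2.trans h1)))
      (sinPowIntegral_pos n ht.1 (ht.2.trans h1))
  have h := hmono (left_mem_Icc.2 h0.le) (right_mem_Icc.2 h0.le) h0
  simp only [Real.sin_zero, sinPowIntegral_zero, mul_zero, sub_zero] at h
  rw [zero_pow (by omega)] at h
  linarith

/-- The derivative has the sign of (n-1) cos t · I(t) - sinⁿ t, with I the integral. For cos t ≥ 0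
the previous inequality makes this negative; for cos t < 0 it is clear. -/
theorem sin_pow_div_sinPowIntegral_antitoneOn {n : ℕ} (hn : 2 ≤ n) :
    AntitoneOn (fun t => Real.sin t ^ (n - 1) / sinPowIntegral n t) (Ioo 0 Real.pi) := by
  have hd : ∀ t ∈ Ioo 0 Real.pi, HasDerivAt
      (fun t => Real.sin t ^ (n - 1) / sinPowIntegral n t)
      ((((n - 1 : ℕ) : ℝ) * Real.sin t ^ (n - 1 - 1) * Real.cos t * sinPowIntegral n t -
        Real.sin t ^ (n - 1) * Real.sin t ^ (n - 1)) / sinPowIntegral n t ^ 2) t := by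
    intro t ht
    exact ((Real.hasDerivAt_sin t).pow (n - 1)).div (hasDerivAt_sinPowIntegral n t)
      (sinPowIntegral_pos n ht.1 ht.2).ne'
  refine antitoneOn_of_deriv_nonpos (convex_Ioo _ _)
    (fun t ht => (hd t ht).continuousAt.continuousWithinAt)
    (fun t ht => (hd t (interior_subset ht)).differentiableAt.differentiableWithinAt)
    (fun t ht => ?_)
  replace ht := interior_subset ht
  rw [(hd t ht).deriv]
  refine div_nonpos_of_nonpos_of_nonneg ?_ (sq_nonneg _)
  obtain ⟨k, rfl⟩ : ∃ k, n = k + 2 := ⟨n - 2, by omega⟩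
  have hs := Real.sin_pos_of_pos_of_lt_pi ht.1 ht.2
  have hI := sinPowIntegral_pos (k + 2) ht.1 ht.2
  have h := mul_cos_mul_sinPowIntegral_lt (n := k + 2) (by omega) ht.1 ht.2
  have key : ((k : ℝ) + 1) * Real.cos t * sinPowIntegral (k + 2) t ≤ Real.sin t ^ (k + 2) := by
    push_cast at h
    rcases le_or_gt 0 (Real.cos t) with hc | hc
    · nlinarith [mul_nonneg hc hI.le]
    · have : (k + 1 : ℝ) * Real.cos t * sinPowIntegral (k + 2) t ≤ 0 :=
        mul_nonpos_of_nonpos_of_nonneg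
          (mul_nonpos_of_nonneg_of_nonpos (by positivity) hc.le) hI.le
      exact this.trans (pow_pos hs _).le
  have hs' : 0 < Real.sin t ^ k := pow_pos hs k
  have e : k + 2 - 1 = k + 1 := by omega
  have e' : k + 2 - 1 - 1 = k := by omega
  rw [e]
  have e'' : k + 1 - 1 = k := by omega
  rw [e'']
  push_cast
  have := mul_le_mul_of_nonneg_left key hs'.le
  have e3 : Real.sin t ^ (k + 1) * Real.sin t ^ (k + 1) =
      Real.sin t ^ k * Real.sin t ^ (k + 2) := by ring
  rw [e3]
  linarith

theorem muTilde_eq {n : ℕ} (δ : ℝ) :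
    muTilde n δ = n + Real.sin δ ^ (n - 2) * Real.cos δ / sinPowIntegral n δ := rfl

/-- Written as n + cot t · (sinⁿ⁻¹ t / I(t)), the second summand is a product of two nonnegative
decreasing factors. -/
theorem muTilde_antitoneOn {n : ℕ} (hn : 2 ≤ n) :
    AntitoneOn (muTilde n) (Ioo 0 (Real.pi / 2)) := by
  intro a ha b hb hab
  have hpi := Real.pi_pos
  have hsa := Real.sin_pos_of_pos_of_lt_pi ha.1 (by linarith [ha.2])
  have hsb := Real.sin_pos_of_pos_of_lt_pi hb.1 (by linarith [hb.2])
  have hcb : 0 ≤ Real.cos b := (Real.cos_pos_of_mem_Ioo ⟨by linarith [hb.1], hb.2⟩).le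
  have hca : 0 ≤ Real.cos a := (Real.cos_pos_of_mem_Ioo ⟨by linarith [ha.1], ha.2⟩).le
  have hI := sinPowIntegral_pos n hb.1 (by linarith [hb.2])
  have hform : ∀ t, Real.sin t ≠ 0 → muTilde n t =
      n + Real.cos t / Real.sin t * (Real.sin t ^ (n - 1) / sinPowIntegral n t) := by
    intro t ht
    obtain ⟨k, rfl⟩ : ∃ k, n = k + 2 := ⟨n - 2, by omega⟩
    rw [muTilde_eq]
    have e : k + 2 - 1 = k + 1 := by omega
    have e' : k + 2 - 2 = k := by omega
    rw [e, e', pow_succ]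
    field_simp
  rw [hform a hsa.ne', hform b hsb.ne']
  have h1 : Real.cos b / Real.sin b ≤ Real.cos a / Real.sin a := by
    rw [div_le_div_iff₀ hsb hsa]
    have h2 : Real.cos b ≤ Real.cos a :=
      Real.cos_le_cos_of_nonneg_of_le_pi ha.1.le (by linarith [hb.2]) hab
    have h3 : Real.sin a ≤ Real.sin b :=
      Real.sin_le_sin_of_le_of_le_pi_div_two (by linarith [ha.1]) hb.2.le hab
    exact mul_le_mul h2 h3 hsa.le hca
  have h2 := sin_pow_div_sinPowIntegral_antitoneOn hn
    ⟨ha.1, by linarith [ha.2]⟩ ⟨hb.1, by linarith [hb.2]⟩ hab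
  have := mul_le_mul h1 h2 (div_nonneg (pow_nonneg hsb.le _) hI.le) (div_nonneg hca hsa.le)
  simpa using this

/-- `muTilde n δ > n / sin² δ`, in product form. -/
theorem lt_muTilde_mul_sin_sq {n : ℕ} (hn : 2 ≤ n) {δ : ℝ} (h : δ ∈ Ioo 0 (Real.pi / 2)) :
    n < muTilde n δ * Real.sin δ ^ 2 := by
  have hpi := Real.pi_pos
  have hs := Real.sin_pos_of_pos_of_lt_pi h.1 (by linarith [h.2])
  have hc : 0 < Real.cos δ := Real.cos_pos_of_mem_Ioo ⟨by linarith [h.1], h.2⟩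
  have hI := sinPowIntegral_pos n h.1 (by linarith [h.2])
  have h1 := mul_cos_mul_sinPowIntegral_lt (n := n) (by omega) h.1 (by linarith [h.2])
  obtain ⟨k, rfl⟩ : ∃ k, n = k + 2 := ⟨n - 2, by omega⟩
  rw [muTilde_eq]
  have e' : k + 2 - 2 = k := by omega
  rw [e', add_mul, div_mul_eq_mul_div]
  have h2 : ((k + 2 : ℕ) : ℝ) * Real.cos δ ^ 2 <
      Real.sin δ ^ k * Real.cos δ * Real.sin δ ^ 2 / sinPowIntegral (k + 2) δ := by
    rw [lt_div_iff₀ hI]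
    have := mul_lt_mul_of_pos_left h1 hc
    calc _ = Real.cos δ * ((k + 2 : ℕ) * Real.cos δ * sinPowIntegral (k + 2) δ) := by ring
      _ < Real.cos δ * Real.sin δ ^ (k + 2) := this
      _ = _ := by ring
  have h3 := Real.sin_sq_add_cos_sq δ
  calc ((k + 2 : ℕ) : ℝ) = (k + 2 : ℕ) * Real.sin δ ^ 2 + (k + 2 : ℕ) * Real.cos δ ^ 2 := by
        rw [← mul_add, h3, mul_one]
    _ < _ := by linarith

theorem lt_muTilde {n : ℕ} {δ : ℝ} (h : δ ∈ Ioo 0 (Real.pi / 2)) :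
    n < muTilde n δ := by
  have hpi := Real.pi_pos
  have hs := Real.sin_pos_of_pos_of_lt_pi h.1 (by linarith [h.2])
  have hc : 0 < Real.cos δ := Real.cos_pos_of_mem_Ioo ⟨by linarith [h.1], h.2⟩
  have hI := sinPowIntegral_pos n h.1 (by linarith [h.2])
  rw [muTilde_eq]
  have : 0 < Real.sin δ ^ (n - 2) * Real.cos δ / sinPowIntegral n δ := by positivity
  linarith

/-! ### Sign of the comparison function F_μ̃ -/

/-- The reciprocal of the first factor of `alpha`. -/
noncomputable def alphaDenom (n : ℕ) (m c : ℝ) : ℝ := 1 - (1 - n / (2 * m)) * c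

/-- Clearing the denominator β isolates a constant minus a product βT. For μ = μ̃ both factors grow
with δ, which is what the uniqueness of the zero rests on. -/
theorem thresholdFun_eq {n : ℕ} (hn : 2 ≤ n) (μ : ℝ → ℝ) {δ : ℝ} (hs : Real.sin δ ≠ 0)
    (hβ : alphaDenom n (μ δ) (Real.cos δ) ≠ 0) :
    4 * alphaDenom n (μ δ) (Real.cos δ) * thresholdFun n μ δ =
      (n + 1) / (2 * n) -
        alphaDenom n (μ δ) (Real.cos δ) * (n + 3 - (n - 1) / Real.sin δ ^ 2) := by
  have hn' : (n : ℝ) ≠ 0 := Nat.cast_ne_zero.2 (two_pos.trans_le hn).ne'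
  rw [thresholdFun, alpha, Real.cos_sq']
  change 4 * alphaDenom n (μ δ) (Real.cos δ) *
    ((alphaDenom n (μ δ) (Real.cos δ))⁻¹ * _ + _) = _
  field_simp
  ring

theorem alphaDenom_pos {n : ℕ} {m c : ℝ} (hc0 : 0 ≤ c) (hc1 : c < 1)
    (hm : 0 ≤ m) : 0 < alphaDenom n m c := by
  rw [alphaDenom]
  have : 0 ≤ (n : ℝ) / (2 * m) := by positivity
  nlinarith

/-- As δ grows, μ̃ falls, so 1 - n/(2μ̃) does not increase; it is positive, and cos δ strictly
falls. -/
theorem alphaDenom_muTilde_mono {n : ℕ} (hn : 2 ≤ n) {a b : ℝ} (ha : a ∈ Ioo 0 (Real.pi / 2))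
    (hb : b ∈ Ioo 0 (Real.pi / 2)) (hab : a < b) :
    alphaDenom n (muTilde n a) (Real.cos a) < alphaDenom n (muTilde n b) (Real.cos b) := by
  have hpi := Real.pi_pos
  have hn0 : (0 : ℝ) < n := by positivity
  have hma := lt_muTilde (n := n) ha
  have hmb := lt_muTilde (n := n) hb
  have hcb : 0 < Real.cos b := Real.cos_pos_of_mem_Ioo ⟨by linarith [hb.1], hb.2⟩
  have hc : Real.cos b < Real.cos a :=
    Real.cos_lt_cos_of_nonneg_of_le_pi ha.1.le (by linarith [hb.2]) hab
  have h1 : (n : ℝ) / (2 * muTilde n a) ≤ n / (2 * muTilde n b) :=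
    div_le_div_of_nonneg_left hn0.le (by linarith)
      (by linarith [muTilde_antitoneOn hn ha hb hab.le])
  have h2 : (n : ℝ) / (2 * muTilde n a) < 1 := by
    rw [div_lt_one (by linarith)]; linarith
  rw [alphaDenom, alphaDenom]
  nlinarith

theorem sub_div_sin_sq_mono {n : ℕ} (hn : 2 ≤ n) {a b : ℝ} (ha : a ∈ Ioo 0 (Real.pi / 2))
    (hb : b ∈ Ioo 0 (Real.pi / 2)) (hab : a ≤ b) :
    (n + 3 - (n - 1) / Real.sin a ^ 2 : ℝ) ≤ n + 3 - (n - 1) / Real.sin b ^ 2 := by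
  have hpi := Real.pi_pos
  have hsa := Real.sin_pos_of_pos_of_lt_pi ha.1 (by linarith [ha.2])
  have h3 : Real.sin a ≤ Real.sin b :=
    Real.sin_le_sin_of_le_of_le_pi_div_two (by linarith [ha.1]) hb.2.le hab
  have hn1 : (0 : ℝ) ≤ n - 1 := by
    have : (2 : ℝ) ≤ n := by exact_mod_cast hn
    linarith
  have : (n - 1 : ℝ) / Real.sin b ^ 2 ≤ (n - 1) / Real.sin a ^ 2 := by gcongr
  linarith

theorem sin_pos_cos_mem_Ioo {δ : ℝ} (h : δ ∈ Ioo 0 (Real.pi / 2)) :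
    0 < Real.sin δ ∧ 0 < Real.cos δ ∧ Real.cos δ < 1 := by
  have hpi := Real.pi_pos
  have hs := Real.sin_pos_of_pos_of_lt_pi h.1 (by linarith [h.2])
  refine ⟨hs, Real.cos_pos_of_mem_Ioo ⟨by linarith [h.1], h.2⟩, ?_⟩
  nlinarith [Real.sin_sq_add_cos_sq δ, Real.cos_le_one δ]

/-- If `F(d) = 0` and `F(δ) ≤ 0` for the comparison function, then `d ≤ δ`. -/
theorem le_of_thresholdFun_muTilde {n : ℕ} (hn : 2 ≤ n) {d δ : ℝ}
    (hd : d ∈ Ioo 0 (Real.pi / 2)) (hδ : δ ∈ Ioo 0 (Real.pi / 2))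
    (h0 : thresholdFun n (muTilde n) d = 0) (h1 : thresholdFun n (muTilde n) δ ≤ 0) :
    d ≤ δ := by
  by_contra! hlt
  obtain ⟨hsd, hcd, hcd1⟩ := sin_pos_cos_mem_Ioo hd
  obtain ⟨hsδ, hcδ, hcδ1⟩ := sin_pos_cos_mem_Ioo hδ
  have hn0 : (0 : ℝ) < n := by positivity
  have hβd := alphaDenom_pos (n := n) hcd.le hcd1 (hn0.trans (lt_muTilde hd)).le
  have hβδ := alphaDenom_pos (n := n) hcδ.le hcδ1 (hn0.trans (lt_muTilde hδ)).le
  have e0 := thresholdFun_eq hn (muTilde n) hsd.ne' hβd.ne'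
  have e1 := thresholdFun_eq hn (muTilde n) hsδ.ne' hβδ.ne'
  rw [h0] at e0
  have h2 := mul_nonpos_of_nonneg_of_nonpos
    (mul_pos four_pos hβδ).le h1
  rw [e1] at h2
  have hT := sub_div_sin_sq_mono hn hδ hd hlt.le
  have hβ := alphaDenom_muTilde_mono hn hδ hd hlt
  have hpos : (0 : ℝ) < (n + 1) / (2 * n) := by positivity
  set β₁ := alphaDenom n (muTilde n δ) (Real.cos δ)
  set β₂ := alphaDenom n (muTilde n d) (Real.cos d)
  set T₁ : ℝ := n + 3 - (n - 1) / Real.sin δ ^ 2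
  set T₂ : ℝ := n + 3 - (n - 1) / Real.sin d ^ 2
  -- F(δ) ≤ 0 means β₁T₁ ≥ (n+1)/(2n) > 0, so T₁ > 0. Then β₂T₂ > β₁T₁, contradicting β₂T₂ =
  -- (n+1)/(2n).
  have hT1 : 0 < T₁ := by
    by_contra! hT1
    nlinarith [mul_nonpos_of_nonneg_of_nonpos hβδ.le hT1]
  nlinarith [mul_lt_mul_of_pos_right hβ hT1, mul_le_mul_of_nonneg_left hT hβd.le]

theorem continuousAt_thresholdFun_muTilde {n : ℕ} (hn : 2 ≤ n) {δ : ℝ} (h0 : 0 < δ)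
    (h1 : δ ≤ Real.pi / 2) : ContinuousAt (thresholdFun n (muTilde n)) δ := by
  have hpi := Real.pi_pos
  have hn0 : (0 : ℝ) < n := by positivity
  have hs := Real.sin_pos_of_pos_of_lt_pi h0 (by linarith)
  have hc : 0 ≤ Real.cos δ := Real.cos_nonneg_of_mem_Icc ⟨by linarith, h1⟩
  have hc1 : Real.cos δ < 1 := by
    nlinarith [Real.sin_sq_add_cos_sq δ, Real.cos_le_one δ]
  have hI := sinPowIntegral_pos n h0 (by linarith)
  have hmu : ContinuousAt (muTilde n) δ := by
    have : muTilde n = fun δ => n + Real.sin δ ^ (n - 2) * Real.cos δ / sinPowIntegral n δ := rfl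
    rw [this]
    refine continuousAt_const.add (ContinuousAt.div (by fun_prop) ?_ hI.ne')
    exact (hasDerivAt_sinPowIntegral n δ).continuousAt
  have hm : 0 < muTilde n δ := by
    rw [muTilde_eq]
    positivity
  have hβ := alphaDenom_pos (n := n) hc hc1 hm.le
  have hα : ContinuousAt (fun δ => alphaDenom n (muTilde n δ) (Real.cos δ)) δ := by
    unfold alphaDenom
    refine continuousAt_const.sub (ContinuousAt.mul ?_ (by fun_prop))
    exact continuousAt_const.sub (continuousAt_const.div (continuousAt_const.mul hmu) (by positivity))
  have : thresholdFun n (muTilde n) = fun δ =>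
    (alphaDenom n (muTilde n δ) (Real.cos δ))⁻¹ * ((n + 1) / (8 * n)) +
      ((n + 3) * Real.cos δ ^ 2 - 4) / (4 * Real.sin δ ^ 2) := rfl
  rw [this]
  refine ((hα.inv₀ hβ.ne').mul continuousAt_const).add (ContinuousAt.div ?_ ?_ (by positivity)) <;>
  fun_prop

theorem existsUnique_thresholdFun_muTilde {n : ℕ} (hn : 2 ≤ n) :
    ∃! d : ℝ, d ∈ Ioo 0 (Real.pi / 2) ∧ thresholdFun n (muTilde n) d = 0 := by
  have hpi := Real.pi_pos
  have hn0 : (2 : ℝ) ≤ n := by exact_mod_cast hn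
  have hq : (4 / (n + 3) : ℝ) < 1 := by
    rw [div_lt_one (by positivity)]; linarith
  have hq0 : (0 : ℝ) < 4 / (n + 3) := by positivity
  -- At this angle (n+3)cos² - 4 vanishes, so F equals the positive term `alpha`. At π/2 its value
  -- is (n+1)/(8n) - 1 < 0.
  set a : ℝ := Real.arccos (Real.sqrt (4 / (n + 3))) with ha
  have hsq1 : Real.sqrt (4 / (n + 3)) < 1 := by
    rw [Real.sqrt_lt' one_pos]; linarith
  have ha0 : 0 < a := Real.arccos_pos.2 hsq1
  have ha1 : a < Real.pi / 2 := Real.arccos_lt_pi_div_two.2 (Real.sqrt_pos.2 hq0)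
  have hca : Real.cos a = Real.sqrt (4 / (n + 3)) :=
    Real.cos_arccos (by linarith [Real.sqrt_nonneg (4 / (n + 3) : ℝ)]) hsq1.le
  obtain ⟨hsa, hca0, hca1⟩ := sin_pos_cos_mem_Ioo ⟨ha0, ha1⟩
  have hmu := lt_muTilde (n := n) ⟨ha0, ha1⟩
  have hFa : 0 < thresholdFun n (muTilde n) a := by
    have hβ := alphaDenom_pos (n := n) hca0.le hca1 (by linarith : 0 ≤ muTilde n a)
    have e : (n + 3 : ℝ) * Real.cos a ^ 2 - 4 = 0 := by
      rw [hca, Real.sq_sqrt hq0.le]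
      field_simp
      ring
    rw [thresholdFun, alpha, e, zero_div, add_zero]
    exact mul_pos (inv_pos.2 hβ) (by positivity)
  have hFb : thresholdFun n (muTilde n) (Real.pi / 2) < 0 := by
    rw [thresholdFun, alpha, Real.cos_pi_div_two, Real.sin_pi_div_two]
    have : ((n + 1) / (8 * n) : ℝ) < 1 := by
      rw [div_lt_one (by positivity)]; linarith
    norm_num
    linarith
  have hivt := intermediate_value_Icc' ha1.le (f := thresholdFun n (muTilde n))
    (fun t ht => (continuousAt_thresholdFun_muTilde hn (ha0.trans_le ht.1)
      ht.2).continuousWithinAt)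
  obtain ⟨d, hd, hd0⟩ := hivt ⟨hFb.le, hFa.le⟩
  have hdI : d ∈ Ioo 0 (Real.pi / 2) := by
    refine ⟨ha0.trans_le hd.1, lt_of_le_of_ne hd.2 ?_⟩
    rintro rfl
    linarith
  refine ⟨d, ⟨hdI, hd0⟩, ?_⟩
  rintro y ⟨hy, hy0⟩
  exact le_antisymm (le_of_thresholdFun_muTilde hn hy hdI hy0 hd0.le)
    (le_of_thresholdFun_muTilde hn hdI hy hd0 hy0.le)

/-! ### The quartic -/

/-- Up to the positive factor `x`, the quartic is strictly increasing on `(0, ∞)`. -/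
theorem quartic_cross_lt {n : ℕ} (hn : 2 ≤ n) {x y : ℝ} (hx : 0 < x) (hxy : x < y) :
    y * quartic n x < x * quartic n y := by
  have hn0 : (2 : ℝ) ≤ n := by exact_mod_cast hn
  have hy : 0 < y := hx.trans hxy
  -- Division by x turns the negative linear coefficient 1-3n into a constant, which cancels, and
  -- -(7n-1)/x is increasing; hence every term of the bracket is positive.
  have h : x * quartic n y - y * quartic n x = (y - x) *
      (n * (n + 3) * (x * y * (x ^ 2 + x * y + y ^ 2)) + n * (n + 3) * (x * y * (x + y)) +
        2 * n * (n + 1) * (x * y) + (7 * n - 1)) := by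
    unfold quartic
    ring
  have h7 : (0 : ℝ) < 7 * n - 1 := by linarith
  have : 0 < (y - x) * (n * (n + 3) * (x * y * (x ^ 2 + x * y + y ^ 2)) +
      n * (n + 3) * (x * y * (x + y)) + 2 * n * (n + 1) * (x * y) + (7 * n - 1)) :=
    mul_pos (sub_pos.2 hxy) (by positivity)
  linarith

theorem existsUnique_quartic {n : ℕ} (hn : 2 ≤ n) :
    ∃! κ : ℝ, κ ∈ Ioo (0 : ℝ) 1 ∧ quartic n κ = 0 := by
  have hn0 : (2 : ℝ) ≤ n := by exact_mod_cast hn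
  have hc : Continuous (quartic n) := by unfold quartic; fun_prop
  have h0 : quartic n 0 < 0 := by simp only [quartic]; linarith
  have h1 : 0 < quartic n 1 := by simp only [quartic]; nlinarith
  obtain ⟨κ, hκ, hκ0⟩ := intermediate_value_Icc zero_le_one hc.continuousOn ⟨h0.le, h1.le⟩
  have hκI : κ ∈ Ioo (0 : ℝ) 1 := by
    refine ⟨lt_of_le_of_ne hκ.1 ?_, lt_of_le_of_ne hκ.2 ?_⟩
    · rintro rfl; linarith
    · rintro rfl; linarith
  refine ⟨κ, ⟨hκI, hκ0⟩, ?_⟩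
  rintro y ⟨hy, hy0⟩
  rcases lt_trichotomy y κ with h | h | h
  · have := quartic_cross_lt hn hy.1 h
    rw [hy0, hκ0] at this
    simp at this
  · exact h
  · have := quartic_cross_lt hn hκI.1 h
    rw [hy0, hκ0] at this
    simp at this

theorem lt_of_quartic_neg {n : ℕ} (hn : 2 ≤ n) {c κ : ℝ} (hc : 0 < c) (hκ : 0 < κ)
    (hqc : quartic n c < 0) (hqκ : quartic n κ = 0) : c < κ := by
  by_contra! h
  rcases h.eq_or_lt with rfl | h
  · linarith
  · have := quartic_cross_lt hn hκ h
    rw [hqκ, mul_zero] at this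
    nlinarith

/-- The quartic is c(c+1)(n(n+3)c² - (3n-1)) plus c²(2n²+5n-1) - (7n-1). If the second part were
nonnegative, the first would be positive, because (7n-1)/(2n²+5n-1) exceeds (3n-1)/(n(n+3)). -/
theorem sq_lt_of_quartic_neg {n : ℕ} (hn : 2 ≤ n) {c : ℝ} (hc : 0 < c)
    (hqc : quartic n c < 0) : c ^ 2 < (7 * n - 1) / (2 * n ^ 2 + 5 * n - 1) := by
  have hn0 : (2 : ℝ) ≤ n := by exact_mod_cast hn
  have hD : (0 : ℝ) < 2 * n ^ 2 + 5 * n - 1 := by nlinarith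
  have hE : (0 : ℝ) < n * (n + 3) := by positivity
  rw [lt_div_iff₀ hD]
  by_contra! h
  have h1 : (3 * n - 1 : ℝ) < n * (n + 3) * c ^ 2 := by
    have h2 : (0 : ℝ) < (7 * n - 1) * (n * (n + 3)) - (3 * n - 1) * (2 * n ^ 2 + 5 * n - 1) := by
      have e : (7 * n - 1) * (n * (n + 3)) - (3 * n - 1) * (2 * n ^ 2 + 5 * n - 1) =
        (n ^ 3 + 7 * n ^ 2 + 5 * n - 1 : ℝ) := by ring
      rw [e]
      nlinarith [pow_pos (by linarith : (0 : ℝ) < n) 3]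
    have h3 := mul_le_mul_of_nonneg_right h hE.le
    by_contra! h4
    have h5 := mul_le_mul_of_nonneg_right h4 hD.le
    nlinarith
  have h2 : 0 < c * (c + 1) * (n * (n + 3) * c ^ 2 - (3 * n - 1)) :=
    mul_pos (by positivity) (by linarith)
  have e : quartic n c = c * (c + 1) * (n * (n + 3) * c ^ 2 - (3 * n - 1)) +
      (c ^ 2 * (2 * n ^ 2 + 5 * n - 1) - (7 * n - 1)) := by
    unfold quartic; ring
  linarith

/-! ### From a zero of F_μ to the quartic inequality -/

/-- Only n/(2m) depends on m. The case m = 0 covers the default value of `neumannMu`: division by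
zero gives n/(2m) = 0, which makes the bracket 1 - cos δ, again smaller. Thus the existence of a
first eigenvalue is never needed. -/
theorem alphaDenom_lt_of_muTilde_lt {n : ℕ} (hn : 2 ≤ n) {m δ : ℝ}
    (hδ : δ ∈ Ioo 0 (Real.pi / 2)) (hm : m = 0 ∨ muTilde n δ < m) :
    0 < alphaDenom n m (Real.cos δ) ∧
      alphaDenom n m (Real.cos δ) < alphaDenom n (muTilde n δ) (Real.cos δ) := by
  obtain ⟨hs, hc, hc1⟩ := sin_pos_cos_mem_Ioo hδ
  have hn0 : (0 : ℝ) < n := by positivity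
  have hmu := hn0.trans (lt_muTilde hδ)
  have hm0 : 0 ≤ m := by rcases hm with h | h <;> linarith
  refine ⟨alphaDenom_pos hc.le hc1 hm0, ?_⟩
  have h : (n : ℝ) / (2 * m) < n / (2 * muTilde n δ) := by
    rcases hm with rfl | h
    · simp only [mul_zero, div_zero]
      positivity
    · exact div_lt_div_of_pos_left hn0 (by linarith) (by linarith)
  rw [alphaDenom, alphaDenom]
  nlinarith

theorem thresholdFun_muTilde_neg {n : ℕ} (hn : 2 ≤ n) {μ : ℝ → ℝ} {δ : ℝ}
    (hδ : δ ∈ Ioo 0 (Real.pi / 2)) (hm : μ δ = 0 ∨ muTilde n δ < μ δ)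
    (h0 : thresholdFun n μ δ = 0) : thresholdFun n (muTilde n) δ < 0 := by
  obtain ⟨h1, h2⟩ := alphaDenom_lt_of_muTilde_lt hn hδ hm
  have h3 := inv_strictAnti₀ h1 h2
  have hpos : (0 : ℝ) < (n + 1) / (8 * n) := by positivity
  have h4 := mul_lt_mul_of_pos_right h3 hpos
  change (alphaDenom n (μ δ) (Real.cos δ))⁻¹ * _ + _ = 0 at h0
  change (alphaDenom n (muTilde n δ) (Real.cos δ))⁻¹ * _ + _ < 0
  linarith

/-- Since n/(2μ̃) < sin² δ / 2, the bracket is below (1-c)(2+c+c²)/2 with c = cos δ. Substituting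
this in F < 0 and cancelling 1-c leaves the quartic. -/
theorem quartic_cos_neg {n : ℕ} (hn : 2 ≤ n) {δ : ℝ} (hδ : δ ∈ Ioo 0 (Real.pi / 2))
    (h0 : thresholdFun n (muTilde n) δ < 0) : quartic n (Real.cos δ) < 0 := by
  obtain ⟨hs, hc, hc1⟩ := sin_pos_cos_mem_Ioo hδ
  have hn0 : (0 : ℝ) < n := by positivity
  have hmu := hn0.trans (lt_muTilde hδ)
  have hβ := alphaDenom_pos (n := n) hc.le hc1 hmu.le
  have e := thresholdFun_eq hn (muTilde n) hs.ne' hβ.ne'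
  have hsc := Real.sin_sq_add_cos_sq δ
  have hw : (n : ℝ) / (2 * muTilde n δ) < Real.sin δ ^ 2 / 2 := by
    rw [div_lt_div_iff₀ (by positivity) two_pos]
    linarith [lt_muTilde_mul_sin_sq hn hδ]
  have hβ' : alphaDenom n (muTilde n δ) (Real.cos δ) <
      (1 - Real.cos δ) * (2 + Real.cos δ + Real.cos δ ^ 2) / 2 := by
    rw [alphaDenom]
    have : Real.sin δ ^ 2 = 1 - Real.cos δ ^ 2 := by linarith
    rw [this] at hw
    nlinarith
  have hneg := mul_neg_of_pos_of_neg (mul_pos four_pos hβ) h0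
  rw [e] at hneg
  set β := alphaDenom n (muTilde n δ) (Real.cos δ)
  set c := Real.cos δ
  have hs2 : Real.sin δ ^ 2 = (1 - c) * (1 + c) := by linarith
  have hs2' : 0 < (1 - c) * (1 + c) := mul_pos (by linarith) (by linarith)
  rw [hs2] at hneg
  have h1 : (n + 1) / (2 * n) * ((1 - c) * (1 + c)) < β * (4 - (n + 3) * c ^ 2) := by
    have := mul_neg_of_neg_of_pos hneg hs2'
    have e2 : ((n + 1) / (2 * n) - β * (n + 3 - (n - 1) / ((1 - c) * (1 + c)))) *
        ((1 - c) * (1 + c)) = (n + 1) / (2 * n) * ((1 - c) * (1 + c)) -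
          β * (4 - (n + 3) * c ^ 2) := by
      linear_combination β * div_mul_cancel₀ (n - 1 : ℝ) hs2'.ne'
    linarith
  -- The upper bound for β may be inserted only after the sign of its cofactor is known.
  have hT : 0 < 4 - (n + 3) * c ^ 2 := by
    by_contra! hT
    have h2 := mul_nonpos_of_nonneg_of_nonpos hβ.le hT
    have : 0 < (n + 1 : ℝ) / (2 * n) * ((1 - c) * (1 + c)) := by positivity
    linarith
  have h2 := h1.trans (mul_lt_mul_of_pos_right hβ' hT)
  have h3 : (n + 1 : ℝ) * (1 + c) * (1 - c) <
      (n * (2 + c + c ^ 2) * (4 - (n + 3) * c ^ 2)) * (1 - c) := by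
    have := mul_lt_mul_of_pos_left h2 (by positivity : (0 : ℝ) < 2 * n)
    have e3 : (2 * n : ℝ) * ((n + 1) / (2 * n) * ((1 - c) * (1 + c))) =
      (n + 1 : ℝ) * (1 + c) * (1 - c) := by field_simp
    rw [e3] at this
    linarith
  have h4 := lt_of_mul_lt_mul_right h3 (by linarith)
  have e4 : quartic n c = (n + 1) * (1 + c) - n * (2 + c + c ^ 2) * (4 - (n + 3) * c ^ 2) := by
    unfold quartic; ring
  linarith

/-! ### Lower bound for the radial eigenvalue problem -/

theorem deriv_nonneg_of_zero_of_pos {g : ℝ → ℝ} {g' z r : ℝ} (hg : HasDerivAt g g' z)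
    (hz : g z = 0) (hzr : z < r) (hpos : ∀ t ∈ Ioc z r, 0 < g t) : 0 ≤ g' := by
  have h := (hasDerivAt_iff_tendsto_slope.1 hg).mono_left
    (nhdsWithin_mono z (fun x (hx : x ∈ Ioi z) => ne_of_gt hx))
  refine ge_of_tendsto h ?_
  filter_upwards [Ioc_mem_nhdsGT hzr] with t ht
  rw [slope_def_field, hz, sub_zero]
  exact div_nonneg (hpos t ht).le (sub_nonneg.2 ht.1.le)

/-- If a solution of the radial equation is positive on `(z, r]`, vanishes at `z` and has a
maximum at `r` with zero derivative, then `m > muTilde n r`. -/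
theorem muTilde_lt_of_monotone_piece {n : ℕ} (hn : 2 ≤ n) {m lam z r : ℝ} {g g1 g2 : ℝ → ℝ}
    (hlam : (n - 1 : ℝ) ≤ lam) (hz : 0 ≤ z) (hzr : z < r) (hr : r < Real.pi / 2)
    (hg : ∀ t, HasDerivAt g (g1 t) t) (hg1 : ∀ t, HasDerivAt g1 (g2 t) t)
    (hode : ∀ t ∈ Ioo z r, Real.sin t ^ 2 * g2 t + (n - 1) * Real.sin t * Real.cos t * g1 t +
      (m * Real.sin t ^ 2 - lam) * g t = 0)
    (hgz : g z = 0) (hpos : ∀ t ∈ Ioc z r, 0 < g t) (hmax : ∀ t ∈ Ioc z r, g t ≤ g r)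
    (hg1r : g1 r = 0) : muTilde n r < m := by
  have hpi := Real.pi_pos
  have hr0 : 0 < r := hz.trans_lt hzr
  obtain ⟨hsr, hcr, -⟩ := sin_pos_cos_mem_Ioo ⟨hr0, hr⟩
  have hI := sinPowIntegral_pos n hr0 (by linarith)
  have hIz := sinPowIntegral_nonneg n hz (by linarith)
  have hM : 0 < g r := hpos r ⟨hzr, le_rfl⟩
  have hsz : 0 ≤ Real.sin z := Real.sin_nonneg_of_nonneg_of_le_pi hz (by linarith)
  have hgz' := deriv_nonneg_of_zero_of_pos (hg z) hgz hzr hpos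
  obtain ⟨k, rfl⟩ : ∃ k, n = k + 2 := ⟨n - 2, by omega⟩
  -- This is sinⁿ⁺¹ · (g / sin)', the weighted Wronskian of g with sin, where n = k+2. It is ≥ 0 at
  -- z and < 0 at r.
  set Ψ : ℝ → ℝ := fun t => Real.sin t ^ (k + 1) * (g1 t * Real.sin t - g t * Real.cos t) with hΨ
  have hΨd : ∀ t ∈ Ioo z r, HasDerivAt Ψ (Real.sin t ^ k * g t *
      (lam - (k + 1) + ((k + 2) - m) * Real.sin t ^ 2)) t := by
    intro t ht
    have h := ((Real.hasDerivAt_sin t).pow (k + 1)).mul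
      (((hg1 t).mul (Real.hasDerivAt_sin t)).sub ((hg t).mul (Real.hasDerivAt_cos t)))
    refine h.congr_deriv ?_
    have ho := hode t ht
    have hsc := Real.sin_sq_add_cos_sq t
    push_cast at ho ⊢
    simp only [Pi.mul_apply, Pi.sub_apply, Pi.pow_apply]
    linear_combination Real.sin t ^ k * ho - Real.sin t ^ k * g t * (k + 1) * hsc
  have hΨc : Continuous Ψ := by
    have h1 : Continuous g := continuous_iff_continuousAt.2 fun t => (hg t).continuousAt
    have h2 : Continuous g1 := continuous_iff_continuousAt.2 fun t => (hg1 t).continuousAt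
    fun_prop
  have hΨz : 0 ≤ Ψ z := by
    simp only [hΨ, hgz, zero_mul, sub_zero]
    positivity
  have hΨr : Ψ r = -(g r * Real.cos r * Real.sin r ^ (k + 1)) := by
    simp only [hΨ, hg1r, zero_mul, zero_sub]
    ring
  have hsin : ∀ t ∈ Ioo z r, 0 < Real.sin t ∧ Real.sin t < Real.sin r := fun t ht =>
    ⟨Real.sin_pos_of_pos_of_lt_pi (hz.trans_lt ht.1) (by linarith [ht.2]),
      Real.sin_lt_sin_of_lt_of_le_pi_div_two (by linarith [ht.1]) hr.le ht.2⟩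
  push_cast at hlam
  -- For m ≤ n the function Ψ would be nondecreasing, against its signs at z and r.
  have hm : (k + 2 : ℝ) < m := by
    by_contra! hm
    have hmono : MonotoneOn Ψ (Icc z r) := by
      refine monotoneOn_of_deriv_nonneg (convex_Icc _ _) hΨc.continuousOn
        (fun t ht => ?_) (fun t ht => ?_) <;> rw [interior_Icc] at ht
      · exact (hΨd t ht).differentiableAt.differentiableWithinAt
      · rw [(hΨd t ht).deriv]
        have := hpos t ⟨ht.1, ht.2.le⟩
        have hs := (hsin t ht).1
        have h2 : 0 ≤ lam - (k + 1) + ((k + 2) - m) * Real.sin t ^ 2 :=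
          add_nonneg (by linarith) (mul_nonneg (by linarith) (sq_nonneg _))
        positivity
    have := hmono (left_mem_Icc.2 hzr.le) (right_mem_Icc.2 hzr.le) hzr.le
    have h3 : 0 < g r * Real.cos r * Real.sin r ^ (k + 1) := by positivity
    linarith
  -- Now Ψ' ≥ -(m-n) sinⁿ⁻¹ t · g(t) sin t, and g(t) sin t < g(r) sin r on the open interval. So
  -- adding (m-n) g(r) sin r times the volume integral makes Ψ strictly increasing.
  have hmono : StrictMonoOn
      (fun t => Ψ t + (m - (k + 2)) * g r * Real.sin r * sinPowIntegral (k + 2) t) (Icc z r) := by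
    refine strictMonoOn_of_deriv_pos (convex_Icc _ _) (hΨc.continuousOn.add ?_) (fun t ht => ?_)
    · exact continuousOn_const.mul fun t _ =>
        (hasDerivAt_sinPowIntegral (k + 2) t).continuousAt.continuousWithinAt
    · rw [interior_Icc] at ht
      rw [((hΨd t ht).fun_add ((hasDerivAt_sinPowIntegral (k + 2) t).const_mul _)).deriv]
      have hgt := hpos t ⟨ht.1, ht.2.le⟩
      have hgM := hmax t ⟨ht.1, ht.2.le⟩
      obtain ⟨hs, hs'⟩ := hsin t ht
      have e : k + 2 - 1 = k + 1 := by omega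
      rw [e]
      have h4 : g t * Real.sin t < g r * Real.sin r := mul_lt_mul' hgM hs' hs.le hM
      have h5 : 0 < (m - (k + 2)) * Real.sin t ^ (k + 1) * (g r * Real.sin r - g t * Real.sin t) :=
        mul_pos (mul_pos (by linarith) (by positivity)) (by linarith)
      have h6 : 0 ≤ Real.sin t ^ k * g t * (lam - (k + 1)) :=
        mul_nonneg (by positivity) (by linarith)
      have h7 : Real.sin t ^ k * g t * (lam - (k + 1) + ((k + 2) - m) * Real.sin t ^ 2) +
          (m - (k + 2)) * g r * Real.sin r * Real.sin t ^ (k + 1) =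
          (m - (k + 2)) * Real.sin t ^ (k + 1) * (g r * Real.sin r - g t * Real.sin t) +
          Real.sin t ^ k * g t * (lam - (k + 1)) := by ring
      linarith
  have h := hmono (left_mem_Icc.2 hzr.le) (right_mem_Icc.2 hzr.le) hzr
  simp only [hΨr] at h
  have h8 : 0 ≤ (m - (k + 2)) * g r * Real.sin r * sinPowIntegral (k + 2) z :=
    mul_nonneg (mul_nonneg (mul_nonneg (by linarith) hM.le) hsr.le) hIz
  have h9 : g r * Real.sin r * (Real.cos r * Real.sin r ^ k) <
      g r * Real.sin r * ((m - (k + 2)) * sinPowIntegral (k + 2) r) := by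
    have : g r * Real.cos r * Real.sin r ^ (k + 1) =
      g r * Real.sin r * (Real.cos r * Real.sin r ^ k) := by ring
    linarith
  have h10 := lt_of_mul_lt_mul_left h9 (by positivity)
  rw [muTilde_eq]
  have e : k + 2 - 2 = k := by omega
  rw [e]
  have h11 : Real.sin r ^ k * Real.cos r / sinPowIntegral (k + 2) r < m - (k + 2) := by
    rw [div_lt_iff₀ hI]
    linarith
  push_cast
  linarith

theorem muTilde_lt_of_radial_of_pos {n : ℕ} (hn : 2 ≤ n) {m lam δ : ℝ} {g g1 g2 : ℝ → ℝ}
    (hlam : (n - 1 : ℝ) ≤ lam) (hδ : δ ∈ Ioo 0 (Real.pi / 2))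
    (hg : ∀ t, HasDerivAt g (g1 t) t) (hg1 : ∀ t, HasDerivAt g1 (g2 t) t)
    (hode : ∀ t ∈ Ioo 0 δ, Real.sin t ^ 2 * g2 t + (n - 1) * Real.sin t * Real.cos t * g1 t +
      (m * Real.sin t ^ 2 - lam) * g t = 0)
    (hg0 : g 0 = 0) (hbd : g1 δ = 0 ∨ g δ = 0)
    {r : ℝ} (hr : r ∈ Icc 0 δ) (hgr : 0 < g r) (hmax : ∀ t ∈ Icc 0 δ, g t ≤ g r) :
    muTilde n δ < m := by
  have hgc : Continuous g := continuous_iff_continuousAt.2 fun t => (hg t).continuousAt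
  have hr0 : 0 < r := by
    refine lt_of_le_of_ne hr.1 ?_
    rintro rfl
    linarith
  have hg1r : g1 r = 0 := by
    rcases hr.2.eq_or_lt with rfl | hlt
    · rcases hbd with h | h
      · exact h
      · linarith
    · have : IsLocalMax g r := by
        filter_upwards [Icc_mem_nhds hr0 hlt] with t ht using hmax t ht
      exact this.hasDerivAt_eq_zero (hg r)
  -- z is the last zero before the maximum; there is one because g(0) = 0.
  obtain ⟨z, ⟨hzI, hz0⟩, hzmax⟩ :
      ∃ z, IsGreatest (Icc 0 r ∩ {t | g t = 0}) z := by
    refine IsCompact.exists_isGreatest ?_ ⟨0, ⟨le_rfl, hr0.le⟩, hg0⟩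
    exact isCompact_Icc.inter_right (isClosed_eq hgc continuous_const)
  have hz0' : g z = 0 := hz0
  have hzr : z < r := by
    refine lt_of_le_of_ne hzI.2 ?_
    rintro rfl
    linarith
  have hpos : ∀ t ∈ Ioc z r, 0 < g t := by
    intro t ht
    by_contra! hle
    obtain ⟨y, hy, hy0⟩ := intermediate_value_Icc ht.2 hgc.continuousOn ⟨hle, hgr.le⟩
    have := hzmax ⟨⟨hzI.1.trans (ht.1.le.trans hy.1), hy.2⟩, hy0⟩
    linarith [ht.1, hy.1]
  have h := muTilde_lt_of_monotone_piece hn hlam hzI.1 hzr (hr.2.trans_lt hδ.2) hg hg1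
    (fun t ht => hode t ⟨hzI.1.trans_lt ht.1, ht.2.trans_le hr.2⟩) hz0' hpos
    (fun t ht => hmax t ⟨hzI.1.trans ht.1.le, ht.2.trans hr.2⟩) hg1r
  exact (muTilde_antitoneOn hn ⟨hr0, hr.2.trans_lt hδ.2⟩ hδ hr.2).trans_lt h

/-- A nontrivial solution on `(0, δ]` of the radial equation with angular eigenvalue
`lam ≥ n - 1` and Neumann or Dirichlet data at `δ` has `m > muTilde n δ`. -/
theorem muTilde_lt_of_radial {n : ℕ} (hn : 2 ≤ n) {m lam δ : ℝ} {g g1 g2 : ℝ → ℝ}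
    (hlam : (n - 1 : ℝ) ≤ lam) (hδ : δ ∈ Ioo 0 (Real.pi / 2))
    (hg : ∀ t, HasDerivAt g (g1 t) t) (hg1 : ∀ t, HasDerivAt g1 (g2 t) t) (hg2 : Continuous g2)
    (hode : ∀ t ∈ Ioo 0 δ, Real.sin t ^ 2 * g2 t + (n - 1) * Real.sin t * Real.cos t * g1 t +
      (m * Real.sin t ^ 2 - lam) * g t = 0)
    (hbd : g1 δ = 0 ∨ g δ = 0) (hne : ∃ t ∈ Icc 0 δ, g t ≠ 0) :
    muTilde n δ < m := by
  have hgc : Continuous g := continuous_iff_continuousAt.2 fun t => (hg t).continuousAt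
  have hgc1 : Continuous g1 := continuous_iff_continuousAt.2 fun t => (hg1 t).continuousAt
  have hn2 : (2 : ℝ) ≤ n := by exact_mod_cast hn
  -- The equation extends to t = 0 by continuity and reads λ g(0) = 0 there, with λ ≥ n-1 > 0.
  have hg0 : g 0 = 0 := by
    have hcl : IsClosed {t | Real.sin t ^ 2 * g2 t + (n - 1) * Real.sin t * Real.cos t * g1 t +
      (m * Real.sin t ^ 2 - lam) * g t = 0} := isClosed_eq (by fun_prop) continuous_const
    have h0 : (0 : ℝ) ∈ closure (Ioo 0 δ) := by
      rw [closure_Ioo hδ.1.ne]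
      exact ⟨le_rfl, hδ.1.le⟩
    have := hcl.closure_subset_iff.2 hode h0
    simp only [mem_ofPred_eq, Real.sin_zero] at this
    have h2 : lam * g 0 = 0 := by linarith
    exact (mul_eq_zero.1 h2).resolve_left (by linarith)
  obtain ⟨r, hr, hmax⟩ := isCompact_Icc.exists_isMaxOn (nonempty_Icc.2 hδ.1.le)
    (hgc.abs.continuousOn (s := Icc 0 δ))
  have hmax' : ∀ t ∈ Icc 0 δ, |g t| ≤ |g r| := hmax
  obtain ⟨t, ht, hgt⟩ := hne
  have hgr : 0 < |g r| := (abs_pos.2 hgt).trans_le (hmax' t ht)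
  rcases lt_or_gt_of_ne (abs_pos.1 hgr) with h | h
  · refine muTilde_lt_of_radial_of_pos hn (g := fun t => -g t) (g1 := fun t => -g1 t)
      (g2 := fun t => -g2 t) hlam hδ (fun t => (hg t).neg) (fun t => (hg1 t).neg)
      (fun t ht => ?_) (by simp [hg0]) (by simpa using hbd) hr (by simpa using h) (fun t ht => ?_)
    · have := hode t ht
      linarith
    · have h2 := hmax' t ht
      rw [abs_of_neg h] at h2
      exact (neg_le_abs _).trans h2
  · refine muTilde_lt_of_radial_of_pos hn hlam hδ hg hg1 hode hg0 hbd hr h (fun t ht => ?_)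
    have h2 := hmax' t ht
    rw [abs_of_pos h] at h2
    exact (le_abs_self _).trans h2

/-- The radially symmetric case: a nontrivial Neumann solution of the radial equation with
angular eigenvalue `0` and `m ≠ 0` has `m > muTilde n δ`. -/
theorem muTilde_lt_of_radial_zero {n : ℕ} (hn : 2 ≤ n) {m δ : ℝ} {g : ℝ → ℝ}
    (hm : m ≠ 0) (hδ : δ ∈ Ioo 0 (Real.pi / 2)) (hg : ContDiff ℝ ∞ g)
    (hode : ∀ t ∈ Ioo 0 δ, Real.sin t ^ 2 * deriv (deriv g) t +
      (n - 1) * Real.sin t * Real.cos t * deriv g t + m * Real.sin t ^ 2 * g t = 0)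
    (hbd : deriv g δ = 0) (hne : ∃ t ∈ Icc 0 δ, g t ≠ 0) :
    muTilde n δ < m := by
  have hpi := Real.pi_pos
  have hg1 : ContDiff ℝ ∞ (deriv g) := (contDiff_infty_iff_deriv.1 hg).2
  have hg2 : ContDiff ℝ ∞ (deriv (deriv g)) := (contDiff_infty_iff_deriv.1 hg1).2
  have hg3 : ContDiff ℝ ∞ (deriv (deriv (deriv g))) := (contDiff_infty_iff_deriv.1 hg2).2
  have hd0 : ∀ t, HasDerivAt g (deriv g t) t := fun t =>
    (hg.differentiable (by simp) t).hasDerivAt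
  have hd1 : ∀ t, HasDerivAt (deriv g) (deriv (deriv g) t) t := fun t =>
    (hg1.differentiable (by simp) t).hasDerivAt
  have hd2 : ∀ t, HasDerivAt (deriv (deriv g)) (deriv (deriv (deriv g)) t) t := fun t =>
    (hg2.differentiable (by simp) t).hasDerivAt
  have hsin : ∀ t ∈ Ioo 0 δ, 0 < Real.sin t := fun t ht =>
    Real.sin_pos_of_pos_of_lt_pi ht.1 (by linarith [ht.2, hδ.2])
  have hode' : ∀ t ∈ Ioo 0 δ, Real.sin t * deriv (deriv g) t +
      (n - 1) * Real.cos t * deriv g t + m * Real.sin t * g t = 0 := by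
    intro t ht
    have h := hode t ht
    have h2 : Real.sin t * (Real.sin t * deriv (deriv g) t +
      (n - 1) * Real.cos t * deriv g t + m * Real.sin t * g t) = 0 := by linarith
    exact (mul_eq_zero.1 h2).resolve_left (hsin t ht).ne'
  -- The equation divided by sin t and differentiated shows that g' solves the radial equation with
  -- λ = n-1; the Neumann condition on g is the Dirichlet condition on g'.
  refine muTilde_lt_of_radial hn (lam := n - 1) le_rfl hδ hd1 hd2 hg3.continuous
    (fun t ht => ?_) (Or.inr hbd) ?_
  · have hz : HasDerivAt (fun t => Real.sin t * deriv (deriv g) t +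
      (n - 1) * Real.cos t * deriv g t + m * Real.sin t * g t) 0 t := by
      refine (hasDerivAt_const t (0 : ℝ)).congr_of_eventuallyEq ?_
      filter_upwards [Ioo_mem_nhds ht.1 ht.2] with s hs using hode' s hs
    have h := (((Real.hasDerivAt_sin t).mul (hd2 t)).add
      (((Real.hasDerivAt_cos t).const_mul (n - 1 : ℝ)).mul (hd1 t))).add
      (((Real.hasDerivAt_sin t).const_mul m).mul (hd0 t))
    have e := h.unique hz
    have ho := hode' t ht
    linear_combination Real.sin t * e - Real.cos t * ho + (n - 1) * deriv g t *
      Real.sin_sq_add_cos_sq t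
  -- If g' vanished identically, g would be constant and the equation would give m g = 0.
  · by_contra! hzero
    obtain ⟨t, ht, hgt⟩ := hne
    have hconst : ∀ s ∈ Icc 0 δ, g s = g 0 := by
      intro s hs
      refine (convex_Icc 0 δ).is_const_of_fderivWithin_eq_zero (𝕜 := ℝ)
        (hg.differentiable (by simp)).differentiableOn (fun x hx => ?_) hs ⟨le_rfl, hδ.1.le⟩
      have h1 := (hd0 x).hasDerivWithinAt (s := Icc 0 δ)
      rw [hzero x hx] at h1
      have h2 := h1.hasFDerivWithinAt.fderivWithin (uniqueDiffOn_Icc hδ.1 x hx)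
      rw [h2]
      ext
      simp
    have hmid : δ / 2 ∈ Ioo 0 δ := ⟨by linarith [hδ.1], by linarith [hδ.1]⟩
    have h1 : deriv (deriv g) (δ / 2) = 0 := by
      have : deriv g =ᶠ[nhds (δ / 2)] fun _ => 0 := by
        filter_upwards [Ioo_mem_nhds hmid.1 hmid.2] with s hs
        exact hzero s ⟨hs.1.le, hs.2.le⟩
      rw [this.deriv_eq]
      simp
    have h2 := hode' _ hmid
    rw [h1, hzero _ ⟨hmid.1.le, hmid.2.le⟩] at h2
    have h3 : m * (Real.sin (δ / 2) * g (δ / 2)) = 0 := by linarith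
    have h4 := ((mul_eq_zero.1 h3).resolve_left hm)
    have h5 := (mul_eq_zero.1 h4).resolve_left (hsin _ hmid).ne'
    rw [hconst _ ⟨hmid.1.le, hmid.2.le⟩, ← hconst t ht] at h5
    exact hgt h5

/-! ### An invariant measure on the equator orthogonal to p -/

section EquatorMeasure

variable {V : Type*} [NormedAddCommGroup V] [InnerProductSpace ℝ V]

/-- The orthogonal projection off `p`, normalized. -/
noncomputable def equatorMap (p y : V) : V := ‖y - ⟪p, y⟫_ℝ • p‖⁻¹ • (y - ⟪p, y⟫_ℝ • p)

variable [FiniteDimensional ℝ V] [MeasurableSpace V] [BorelSpace V]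

theorem measurable_equatorMap (p : V) : Measurable (equatorMap p) := by
  have h : Continuous fun y : V => y - ⟪p, y⟫_ℝ • p := by fun_prop
  exact h.norm.measurable.inv.smul h.measurable

/-- A rotation invariant finite measure on the unit sphere of the orthogonal complement of `p`. -/
noncomputable def equatorMeasure (p : V) : Measure V :=
  (volume.restrict (Metric.ball (0 : V) 1)).map (equatorMap p)

instance (p : V) : IsFiniteMeasure (equatorMeasure p) := by
  have : IsFiniteMeasure (volume.restrict (Metric.ball (0 : V) 1)) :=
    ⟨by simpa using measure_ball_lt_top⟩
  unfold equatorMeasure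
  infer_instance

theorem ae_equatorMeasure {p : V} (hp : ‖p‖ = 1) (hV : 2 ≤ Module.finrank ℝ V) :
    ∀ᵐ ξ ∂equatorMeasure p, ‖ξ‖ = 1 ∧ ⟪p, ξ⟫_ℝ = 0 := by
  have hmeas : MeasurableSet {ξ : V | ‖ξ‖ = 1 ∧ ⟪p, ξ⟫_ℝ = 0} := by
    refine ((isClosed_eq ?_ ?_).inter (isClosed_eq ?_ ?_)).measurableSet <;> fun_prop
  rw [equatorMeasure, ae_map_iff (measurable_equatorMap p).aemeasurable hmeas]
  have htop : Submodule.span ℝ {p} ≠ ⊤ := by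
    intro h
    have h1 := finrank_span_le_card (R := ℝ) ({p} : Set V)
    rw [h, finrank_top] at h1
    simp at h1
    omega
  -- The map is degenerate only on the line through p, a null set in dimension at least 2.
  have h0 : ∀ᵐ y : V, y ∉ (Submodule.span ℝ {p} : Set V) :=
    measure_eq_zero_iff_ae_notMem.1 (Measure.addHaar_submodule volume _ htop)
  filter_upwards [ae_restrict_of_ae h0] with y hy
  have hz : y - ⟪p, y⟫_ℝ • p ≠ 0 := by
    intro h
    rw [sub_eq_zero] at h
    exact hy (h ▸ Submodule.smul_mem _ _ (Submodule.mem_span_singleton_self p))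
  refine ⟨?_, ?_⟩
  · rw [equatorMap, norm_smul, norm_inv, norm_norm, inv_mul_cancel₀ (norm_ne_zero_iff.2 hz)]
  · rw [equatorMap, inner_smul_right, inner_sub_right, inner_smul_right,
      real_inner_self_eq_norm_sq, hp]
    simp

/-- An isometry fixing p commutes with the projection off p and preserves Lebesgue measure on the
ball. -/
theorem map_equatorMeasure {p : V} (R : V ≃ₗᵢ[ℝ] V) (hR : R p = p) :
    (equatorMeasure p).map R = equatorMeasure p := by
  have hcomm : R ∘ equatorMap p = equatorMap p ∘ R := by
    funext y
    have h1 : ⟪p, R y⟫_ℝ = ⟪p, y⟫_ℝ := by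
      conv_lhs => rw [← hR]
      exact R.inner_map_map p y
    have h2 : R y - ⟪p, R y⟫_ℝ • p = R (y - ⟪p, y⟫_ℝ • p) := by
      rw [h1, map_sub, map_smul, hR]
    simp only [Function.comp_apply, equatorMap, h2, map_smul, R.norm_map]
  have hmp : MeasurePreserving R (volume.restrict (Metric.ball (0 : V) 1))
      (volume.restrict (Metric.ball (0 : V) 1)) := by
    have h := R.measurePreserving.restrict_preimage (s := Metric.ball (0 : V) 1)
      measurableSet_ball
    have hpre : R ⁻¹' Metric.ball (0 : V) 1 = Metric.ball 0 1 := by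
      ext y
      simp
    rwa [hpre] at h
  rw [equatorMeasure, Measure.map_map R.continuous.measurable (measurable_equatorMap p), hcomm,
    ← Measure.map_map (measurable_equatorMap p) R.continuous.measurable, hmp.map_eq]

/-- Full support: ξ is the image of ξ/2, where `equatorMap` is continuous, so h(ξ) ≠ 0 would persist
on a neighbourhood of positive volume in the ball. -/
theorem eq_zero_of_ae_equatorMeasure {p : V} {h : V → ℝ} (hc : Continuous h)
    (h0 : ∀ᵐ ξ ∂equatorMeasure p, h ξ = 0) {ξ : V} (hξ : ‖ξ‖ = 1) (hpξ : ⟪p, ξ⟫_ℝ = 0) :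
    h ξ = 0 := by
  have hmeas : MeasurableSet {ξ : V | h ξ = 0} := (isClosed_eq hc continuous_const).measurableSet
  rw [equatorMeasure, ae_map_iff (measurable_equatorMap p).aemeasurable hmeas] at h0
  by_contra hne
  set y : V := (1 / 2 : ℝ) • ξ with hy
  have hpy : ⟪p, y⟫_ℝ = 0 := by rw [hy, inner_smul_right, hpξ, mul_zero]
  have hyn : ‖y‖ = 1 / 2 := by rw [hy, norm_smul, hξ]; norm_num
  have hz : y - ⟪p, y⟫_ℝ • p ≠ 0 := by
    rw [hpy, zero_smul, sub_zero, ← norm_ne_zero_iff, hyn]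
    norm_num
  have hyξ : equatorMap p y = ξ := by
    rw [equatorMap, hpy, zero_smul, sub_zero, hyn, hy, smul_smul]
    norm_num
  have hcont : ContinuousAt (fun y => h (equatorMap p y)) y := by
    refine hc.continuousAt.comp ?_
    have h1 : Continuous fun y : V => y - ⟪p, y⟫_ℝ • p := by fun_prop
    exact (h1.norm.continuousAt.inv₀ (norm_ne_zero_iff.2 hz)).smul h1.continuousAt
  have hev : ∀ᶠ x in nhds y, h (equatorMap p x) ≠ 0 ∧ x ∈ Metric.ball (0 : V) 1 := by
    refine (hcont.eventually_ne (by rwa [hyξ])).and (Metric.isOpen_ball.mem_nhds ?_)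
    rw [mem_ball_zero_iff, hyn]
    norm_num
  have hpos := Measure.measure_pos_of_mem_nhds (volume : Measure V) hev
  rw [ae_restrict_iff' measurableSet_ball, ae_iff] at h0
  refine hpos.ne' (measure_mono_null (fun x hx => ?_) h0)
  intro hx'
  exact hx.1 (hx' hx.2)

end EquatorMeasure

/-! ### Differentiation under the integral -/

section Parametric

variable {V : Type*} [NormedAddCommGroup V] [NormedSpace ℝ V]
  [FiniteDimensional ℝ V] [MeasurableSpace V] [BorelSpace V] {σ : Measure V} [IsFiniteMeasure σ]

theorem integrable_of_continuous {E : Type*} [NormedAddCommGroup E]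
    (hσ : ∀ᵐ ξ ∂σ, ‖ξ‖ = 1) {f : V → E}
    (hf : Continuous f) : Integrable f σ := by
  have : ProperSpace V := FiniteDimensional.proper_real V
  obtain ⟨C, hC⟩ := (isCompact_closedBall (0 : V) 1).exists_bound_of_continuousOn hf.continuousOn
  refine Integrable.of_bound hf.aestronglyMeasurable C ?_
  filter_upwards [hσ] with ξ hξ
  exact hC ξ (by simp [hξ])

theorem hasDerivAt_integral_of_continuous (hσ : ∀ᵐ ξ ∂σ, ‖ξ‖ = 1) {Φ Φ' : ℝ → V → ℝ}
    (hΦ : Continuous (fun x : ℝ × V => Φ x.1 x.2)) (hΦ' : Continuous (fun x : ℝ × V => Φ' x.1 x.2))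
    (hd : ∀ t ξ, HasDerivAt (fun s => Φ s ξ) (Φ' t ξ) t) (t : ℝ) :
    HasDerivAt (fun s => ∫ ξ, Φ s ξ ∂σ) (∫ ξ, Φ' t ξ ∂σ) t := by
  have : ProperSpace V := FiniteDimensional.proper_real V
  replace hΦ : ∀ t, Continuous (Φ t) := fun t => hΦ.comp (Continuous.prodMk_right t)
  obtain ⟨C, hC⟩ := ((isCompact_closedBall t 1).prod
    (isCompact_closedBall (0 : V) 1)).exists_bound_of_continuousOn hΦ'.continuousOn
  refine (hasDerivAt_integral_of_dominated_loc_of_deriv_le (bound := fun _ => C)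
    (Metric.closedBall_mem_nhds t one_pos)
    (Filter.Eventually.of_forall fun s => (hΦ s).aestronglyMeasurable)
    (integrable_of_continuous hσ (hΦ t)) ?_ ?_ (integrable_const C) ?_).2
  · exact (hΦ'.comp (Continuous.prodMk_right t)).aestronglyMeasurable
  · filter_upwards [hσ] with ξ hξ s hs
    exact hC (s, ξ) ⟨hs, by simp [hξ]⟩
  · exact Filter.Eventually.of_forall fun ξ s _ => hd s ξ

theorem hasDerivAt_integral_of_contDiff (hσ : ∀ᵐ ξ ∂σ, ‖ξ‖ = 1) {Φ : ℝ × V → ℝ}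
    (hΦ : ContDiff ℝ ∞ Φ) (t : ℝ) :
    HasDerivAt (fun s => ∫ ξ, Φ (s, ξ) ∂σ) (∫ ξ, fderiv ℝ Φ (t, ξ) (1, 0) ∂σ) t := by
  refine hasDerivAt_integral_of_continuous hσ (Φ := fun s ξ => Φ (s, ξ))
    (Φ' := fun s ξ => fderiv ℝ Φ (s, ξ) (1, 0))
    hΦ.continuous ?_ (fun s ξ => ?_) t
  · exact (hΦ.continuous_fderiv (by simp)).clm_apply continuous_const
  · exact ((hΦ.differentiable (by simp) (s, ξ)).hasFDerivAt).comp_hasDerivAt s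
      ((hasDerivAt_id s).prodMk (hasDerivAt_const s ξ))

/-- The derivative is again an integral of a smooth function of (s, ξ), so induction on the order
applies. -/
theorem contDiff_integral (hσ : ∀ᵐ ξ ∂σ, ‖ξ‖ = 1) {Φ : ℝ × V → ℝ} (hΦ : ContDiff ℝ ∞ Φ) :
    ContDiff ℝ ∞ (fun s => ∫ ξ, Φ (s, ξ) ∂σ) := by
  rw [contDiff_infty]
  intro k
  induction k generalizing Φ with
  | zero =>
    exact contDiff_zero.2 (continuous_iff_continuousAt.2 fun t =>
      (hasDerivAt_integral_of_contDiff hσ hΦ t).continuousAt)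
  | succ k ih =>
    have hd : deriv (fun s => ∫ ξ, Φ (s, ξ) ∂σ) =
        fun s => ∫ ξ, fderiv ℝ Φ (s, ξ) (1, 0) ∂σ :=
      funext fun t => (hasDerivAt_integral_of_contDiff hσ hΦ t).deriv
    push_cast
    refine contDiff_succ_iff_deriv.2 ⟨fun t =>
      (hasDerivAt_integral_of_contDiff hσ hΦ t).differentiableAt, by simp, ?_⟩
    rw [hd]
    exact ih (Φ := fun x => fderiv ℝ Φ x (1, 0))
      ((hΦ.fderiv_right (by simp)).clm_apply contDiff_const)

end Parametric

/-! ### Integration by parts along rotations -/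

section Skew

variable {V : Type*} [NormedAddCommGroup V] [InnerProductSpace ℝ V]
  [FiniteDimensional ℝ V]

theorem exp_skew_mem_unitary {A : V →L[ℝ] V} (hA : ∀ x y, ⟪A x, y⟫_ℝ = -⟪x, A y⟫_ℝ) (t : ℝ) :
    NormedSpace.exp (t • A) ∈ unitary (V →L[ℝ] V) := by
  let : NormedAlgebra ℚ (V →L[ℝ] V) := NormedAlgebra.restrictScalars ℚ ℝ _
  refine NormedSpace.exp_mem_unitary_of_mem_skewAdjoint ?_
  rw [skewAdjoint.mem_iff, ContinuousLinearMap.star_eq_adjoint, eq_comm,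
    ContinuousLinearMap.eq_adjoint_iff]
  intro x y
  simp [inner_smul_left, inner_smul_right, hA]

variable [MeasurableSpace V] [BorelSpace V]

/-- Integration by parts on the sphere: an infinitesimal rotation fixing `p` has mean zero. -/
theorem integral_fderiv_skew_eq_zero {p : V} (hp : ‖p‖ = 1) (hV : 2 ≤ Module.finrank ℝ V)
    {A : V →L[ℝ] V} (hA : ∀ x y, ⟪A x, y⟫_ℝ = -⟪x, A y⟫_ℝ) (hAp : A p = 0)
    {F : V → ℝ} (hF : ContDiff ℝ ∞ F) :
    ∫ ξ, fderiv ℝ F ξ (A ξ) ∂equatorMeasure p = 0 := by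
  have hσ : ∀ᵐ ξ ∂equatorMeasure p, ‖ξ‖ = 1 :=
    (ae_equatorMeasure hp hV).mono fun _ h => h.1
  have hE : ∀ t : ℝ, HasDerivAt (fun s : ℝ => NormedSpace.exp (s • A))
      (NormedSpace.exp (t • A) * A) t := fun t => hasDerivAt_exp_smul_const A t
  have hEv : ∀ (t : ℝ) (x : V), HasDerivAt (fun s : ℝ => NormedSpace.exp (s • A) x)
      (NormedSpace.exp (t • A) (A x)) t := by
    intro t x
    have := (hE t).clm_apply (hasDerivAt_const t x)
    simpa using this
  have hEc : Continuous (fun s : ℝ => NormedSpace.exp (s • A)) :=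
    continuous_iff_continuousAt.2 fun t => (hE t).continuousAt
  have hfix : ∀ t : ℝ, NormedSpace.exp (t • A) p = p := by
    intro t
    have h := is_const_of_deriv_eq_zero (f := fun s : ℝ => NormedSpace.exp (s • A) p)
      (fun s => (hEv s p).differentiableAt) (fun s => by rw [(hEv s p).deriv, hAp, map_zero]) t 0
    simpa using h
  -- The flow exp(tA) consists of isometries fixing p, so the integral of F along it is constant;
  -- the claim is that its derivative at t = 0 vanishes.
  have hinv : ∀ t : ℝ, ∫ ξ, F (NormedSpace.exp (t • A) ξ) ∂equatorMeasure p =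
      ∫ ξ, F ξ ∂equatorMeasure p := by
    intro t
    let R := Unitary.linearIsometryEquiv ⟨_, exp_skew_mem_unitary hA t⟩
    have hR : ∀ x, R x = NormedSpace.exp (t • A) x := fun x => rfl
    have h := map_equatorMeasure (p := p) R ((hR p).trans (hfix t))
    conv_rhs => rw [← h]
    rw [integral_map R.continuous.aemeasurable hF.continuous.aestronglyMeasurable]
    rfl
  have hd := hasDerivAt_integral_of_continuous hσ
    (Φ := fun t ξ => F (NormedSpace.exp (t • A) ξ))
    (Φ' := fun t ξ => fderiv ℝ F (NormedSpace.exp (t • A) ξ) (NormedSpace.exp (t • A) (A ξ)))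
    (hF.continuous.comp ((hEc.comp continuous_fst).clm_apply continuous_snd)) ?_ ?_ 0
  · simp only [hinv, zero_smul, NormedSpace.exp_zero] at hd
    exact hd.unique (hasDerivAt_const _ _)
  · have h1 : Continuous fun x : ℝ × V => NormedSpace.exp (x.1 • A) x.2 :=
      (hEc.comp continuous_fst).clm_apply continuous_snd
    have h2 : Continuous fun x : ℝ × V => NormedSpace.exp (x.1 • A) (A x.2) :=
      (hEc.comp continuous_fst).clm_apply (A.continuous.comp continuous_snd)
    exact ((hF.continuous_fderiv (by simp)).comp h1).clm_apply h2
  · intro t ξ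
    exact (hF.differentiable (by simp) _).hasFDerivAt.comp_hasDerivAt t (hEv t ξ)

end Skew

/-! ### Powers of linear forms determine a continuous function -/

section Moments

variable {V : Type*} [NormedAddCommGroup V] [InnerProductSpace ℝ V]
  [FiniteDimensional ℝ V] [MeasurableSpace V] [BorelSpace V] {σ : Measure V} [IsFiniteMeasure σ]

/-- The exponential series may be integrated term by term since ⟪ξ, a⟫ is bounded by ‖a‖ on the unit
sphere. -/
theorem integral_mul_cexp_eq_zero_of_moments (hσ : ∀ᵐ ξ ∂σ, ‖ξ‖ = 1) {h : V → ℝ}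
    (hc : Continuous h) (a : V) (hmom : ∀ k : ℕ, ∫ ξ, h ξ * ⟪a, ξ⟫_ℝ ^ k ∂σ = 0) :
    ∫ ξ, (h ξ : ℂ) * Complex.exp (⟪ξ, a⟫_ℝ * Complex.I) ∂σ = 0 := by
  have : ProperSpace V := FiniteDimensional.proper_real V
  obtain ⟨C, hC⟩ := (isCompact_closedBall (0 : V) 1).exists_bound_of_continuousOn hc.continuousOn
  have hC0 : 0 ≤ C := (norm_nonneg _).trans (hC 0 (by simp))
  set F : ℕ → V → ℂ := fun k ξ =>
    (h ξ : ℂ) * ((k.factorial : ℂ)⁻¹ * (⟪ξ, a⟫_ℝ * Complex.I) ^ k) with hF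
  have hFc : ∀ k, Continuous (F k) := by
    intro k
    simp only [hF]
    fun_prop
  have hFi : ∀ k, ∫ ξ, F k ξ ∂σ = 0 := by
    intro k
    have : ∀ ξ, F k ξ = ((k.factorial : ℂ)⁻¹ * Complex.I ^ k) *
        ((h ξ * ⟪a, ξ⟫_ℝ ^ k : ℝ) : ℂ) := by
      intro ξ
      simp only [hF, real_inner_comm a ξ]
      push_cast
      ring
    simp_rw [this]
    rw [integral_const_mul, integral_complex_ofReal, hmom k]
    simp
  have hsum : Summable fun k => ∫ ξ, ‖F k ξ‖ ∂σ := by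
    refine Summable.of_nonneg_of_le (fun k => integral_nonneg fun ξ => norm_nonneg _)
      (fun k => ?_) ((Real.summable_pow_div_factorial ‖a‖).mul_left (C * σ.real univ))
    calc ∫ ξ, ‖F k ξ‖ ∂σ ≤ ∫ _ξ, C * (‖a‖ ^ k / k.factorial) ∂σ := by
          refine integral_mono_ae (integrable_of_continuous hσ (hFc k).norm)
            (integrable_const _) ?_
          filter_upwards [hσ] with ξ hξ
          have h1 : |⟪ξ, a⟫_ℝ| ≤ ‖a‖ := by
            simpa [hξ] using abs_real_inner_le_norm ξ a
          have h2 := hC ξ (by simp [hξ])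
          simp only [hF, norm_mul, norm_pow, norm_inv, Complex.norm_real, Complex.norm_natCast,
            Complex.norm_I, mul_one, Real.norm_eq_abs] at h2 ⊢
          rw [div_eq_inv_mul]
          gcongr
      _ = _ := by
          rw [integral_const, smul_eq_mul]
          ring
  have hs := hasSum_integral_of_summable_integral_norm
    (fun k => integrable_of_continuous hσ (hFc k)) hsum
  simp only [hFi] at hs
  have h0 := hs.unique hasSum_zero
  rw [← h0]
  congr 1
  funext ξ
  rw [Complex.exp_eq_exp_ℂ, NormedSpace.exp_eq_tsum ℂ, ← tsum_mul_left]
  simp [hF]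

/-- The measures with densities h⁺ and h⁻ have the same characteristic function, hence coincide, so
h⁺ = h⁻ almost everywhere. -/
theorem ae_eq_zero_of_moments (hσ : ∀ᵐ ξ ∂σ, ‖ξ‖ = 1) {h : V → ℝ} (hc : Continuous h)
    (hmom : ∀ (a : V) (k : ℕ), ∫ ξ, h ξ * ⟪a, ξ⟫_ℝ ^ k ∂σ = 0) : ∀ᵐ ξ ∂σ, h ξ = 0 := by
  have hi := integrable_of_continuous hσ hc
  have hm1 : Measurable fun ξ => ENNReal.ofReal (h ξ) := hc.measurable.ennreal_ofReal
  have hm2 : Measurable fun ξ => ENNReal.ofReal (-h ξ) := hc.neg.measurable.ennreal_ofReal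
  have : IsFiniteMeasure (σ.withDensity fun ξ => ENNReal.ofReal (h ξ)) :=
    isFiniteMeasure_withDensity_ofReal hi.2
  have : IsFiniteMeasure (σ.withDensity fun ξ => ENNReal.ofReal (-h ξ)) :=
    isFiniteMeasure_withDensity_ofReal hi.neg.2
  have heq : (σ.withDensity fun ξ => ENNReal.ofReal (h ξ)) =
      σ.withDensity fun ξ => ENNReal.ofReal (-h ξ) := by
    refine Measure.ext_of_charFun (funext fun t => ?_)
    rw [charFun_apply, charFun_apply,
      integral_withDensity_eq_integral_toReal_smul hm1 (by simp),
      integral_withDensity_eq_integral_toReal_smul hm2 (by simp), ← sub_eq_zero,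
      ← integral_sub]
    · rw [← integral_mul_cexp_eq_zero_of_moments hσ hc t (hmom t)]
      congr 1
      funext ξ
      rw [← sub_smul, ENNReal.toReal_ofReal', ENNReal.toReal_ofReal', max_zero_sub_max_neg_zero_eq_self]
      simp
    all_goals
      refine integrable_of_continuous hσ ?_
      simp only [ENNReal.toReal_ofReal']
      fun_prop
  have hae := (withDensity_eq_iff hm1.aemeasurable hm2.aemeasurable
    (by simpa using (measure_ne_top (σ.withDensity fun ξ => ENNReal.ofReal (h ξ)) univ))).1 heq
  filter_upwards [hae] with ξ hξ
  rcases le_total 0 (h ξ) with h0 | h0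
  · rw [ENNReal.ofReal_of_nonpos (by linarith : -h ξ ≤ 0), ENNReal.ofReal_eq_zero] at hξ
    linarith
  · rw [ENNReal.ofReal_of_nonpos h0, eq_comm, ENNReal.ofReal_eq_zero] at hξ
    linarith

end Moments

/-! ### The angular Laplacian as a sum of squares of rotations -/

section Rotations

variable {V : Type*} [NormedAddCommGroup V] [InnerProductSpace ℝ V]

/-- The infinitesimal rotation in the plane spanned by two orthonormal vectors. -/
noncomputable def planeRotation (a b : V) : V →L[ℝ] V :=
  (innerSL ℝ a).smulRight b - (innerSL ℝ b).smulRight a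

theorem planeRotation_apply (a b y : V) :
    planeRotation a b y = ⟪a, y⟫_ℝ • b - ⟪b, y⟫_ℝ • a := by
  simp [planeRotation]

theorem planeRotation_skew (a b x y : V) :
    ⟪planeRotation a b x, y⟫_ℝ = -⟪x, planeRotation a b y⟫_ℝ := by
  simp only [planeRotation_apply, inner_sub_left, inner_sub_right, real_inner_smul_left,
    real_inner_smul_right, real_inner_comm x]
  ring

/-- The second derivative of `f` along the one-parameter group generated by `A`. -/
noncomputable def secondDerivAlong (A : V →L[ℝ] V) (f : V → ℝ) (y : V) : ℝ :=
  fderiv ℝ (fderiv ℝ f) y (A y) (A y) + fderiv ℝ f y (A (A y))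

theorem continuous_secondDerivAlong (A : V →L[ℝ] V) {f : V → ℝ} (hf : ContDiff ℝ ∞ f) :
    Continuous (secondDerivAlong A f) := by
  have h1 : ContDiff ℝ ∞ (fderiv ℝ f) := hf.fderiv_right (by simp)
  have h2 : Continuous (fderiv ℝ (fderiv ℝ f)) := h1.continuous_fderiv (by simp)
  exact ((h2.clm_apply A.continuous).clm_apply A.continuous).add
    (h1.continuous.clm_apply (A.continuous.comp A.continuous))

/-- The sum of the second derivatives along all coordinate plane rotations at a unit vector. -/
theorem sum_planeRotation {n : ℕ} {c : Fin n → V} (hc : Orthonormal ℝ c) {y : V}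
    (hy : ∑ i, ⟪c i, y⟫_ℝ • c i = y) (hy1 : ‖y‖ = 1)
    (B : V →L[ℝ] V →L[ℝ] ℝ) (l : V →L[ℝ] ℝ) :
    ∑ i, ∑ j, (B (planeRotation (c i) (c j) y) (planeRotation (c i) (c j) y) +
      l (planeRotation (c i) (c j) (planeRotation (c i) (c j) y))) =
    2 * ∑ j, B (c j) (c j) - 2 * B y y - 2 * (n - 1) * l y := by
  set α : Fin n → ℝ := fun i => ⟪c i, y⟫_ℝ with hα
  have hα1 : ∑ i, α i ^ 2 = 1 := by
    have h : ⟪∑ i, ⟪c i, y⟫_ℝ • c i, y⟫_ℝ = 1 := by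
      rw [hy, real_inner_self_eq_norm_sq, hy1, one_pow]
    rw [sum_inner] at h
    rw [← h]
    refine Finset.sum_congr rfl fun i _ => ?_
    rw [real_inner_smul_left, sq]
  have hByy : B y y = ∑ i, ∑ j, α i * α j * B (c i) (c j) := by
    conv_lhs => rw [← hy]
    simp only [map_sum, map_smul, sum_apply, smul_apply,
      smul_eq_mul, Finset.mul_sum]
    rw [Finset.sum_comm]
    refine Finset.sum_congr rfl fun i _ => Finset.sum_congr rfl fun j _ => ?_
    simp only [hα]
    ring
  have hly : l y = ∑ i, α i * l (c i) := by
    conv_lhs => rw [← hy]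
    simp [map_sum, hα]
  have hδ : ∀ i j, ⟪c i, c j⟫_ℝ = if i = j then 1 else 0 := orthonormal_iff_ite.1 hc
  have hαi : ∀ i, ⟪c i, y⟫_ℝ = α i := fun _ => rfl
  have hsum : ∑ i, α i * (n * l (c i)) = n * l y := by
    rw [hly, Finset.mul_sum]
    exact Finset.sum_congr rfl fun i _ => by ring
  -- The sum runs over ordered pairs, counting each plane twice. The `if` terms come from ⟪c i, c j⟫
  -- when the rotation is applied a second time.
  have hterm : ∀ i j, B (planeRotation (c i) (c j) y) (planeRotation (c i) (c j) y) +
      l (planeRotation (c i) (c j) (planeRotation (c i) (c j) y)) =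
      α i ^ 2 * B (c j) (c j) + α j ^ 2 * B (c i) (c i) - α i * α j * B (c i) (c j) -
      α j * α i * B (c j) (c i) - α i * l (c i) - α j * l (c j) +
      ((if i = j then α i * l (c j) else 0) + (if i = j then α j * l (c i) else 0)) := by
    intro i j
    simp only [planeRotation_apply, map_sub, map_smul, sub_apply,
      smul_apply, smul_eq_mul, hδ, hαi, eq_comm (a := j) (b := i), if_true]
    split_ifs <;> ring
  simp only [hterm, Finset.sum_add_distrib, Finset.sum_sub_distrib, Finset.sum_ite_eq,
    Finset.mem_univ, if_true, ← Finset.mul_sum, ← Finset.sum_mul, hα1]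
  rw [Finset.sum_comm (f := fun i j => α j * α i * B (c j) (c i)), ← hByy, ← hly]
  simp only [Finset.sum_const, Finset.card_univ, Fintype.card_fin, nsmul_eq_mul, hsum]
  ring

variable [FiniteDimensional ℝ V] [MeasurableSpace V] [BorelSpace V]

theorem integral_secondDerivAlong_mul {p : V} (hp : ‖p‖ = 1) (hV : 2 ≤ Module.finrank ℝ V)
    {A : V →L[ℝ] V} (hA : ∀ x y, ⟪A x, y⟫_ℝ = -⟪x, A y⟫_ℝ) (hAp : A p = 0)
    {f q : V → ℝ} (hf : ContDiff ℝ ∞ f) (hq : ContDiff ℝ ∞ q) :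
    ∫ ξ, secondDerivAlong A f ξ * q ξ ∂equatorMeasure p =
      ∫ ξ, f ξ * secondDerivAlong A q ξ ∂equatorMeasure p := by
  have hσ : ∀ᵐ ξ ∂equatorMeasure p, ‖ξ‖ = 1 :=
    (ae_equatorMeasure hp hV).mono fun _ h => h.1
  have hd : ∀ {g : V → ℝ}, ContDiff ℝ ∞ g → ∀ y, HasFDerivAt (fun y => fderiv ℝ g y (A y))
      ((fderiv ℝ g y).comp A + (fderiv ℝ (fderiv ℝ g) y).flip (A y)) y := by
    intro g hg y
    have h1 : ContDiff ℝ ∞ (fderiv ℝ g) := hg.fderiv_right (by simp)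
    exact (h1.differentiable (by simp) y).hasFDerivAt.clm_apply A.hasFDerivAt
  have hs : ∀ {g : V → ℝ}, ContDiff ℝ ∞ g → ContDiff ℝ ∞ fun y => fderiv ℝ g y (A y) :=
    fun hg => (hg.fderiv_right (by simp)).clm_apply A.contDiff
  -- Green's identity: differentiating (Af)q - f(Aq) along A, the cross terms cancel and (A²f)q -
  -- f(A²q) remains.
  have h := integral_fderiv_skew_eq_zero hp hV hA hAp
    (F := fun y => fderiv ℝ f y (A y) * q y - f y * fderiv ℝ q y (A y))
    (((hs hf).mul hq).sub (hf.mul (hs hq)))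
  have he : ∀ y, fderiv ℝ (fun y => fderiv ℝ f y (A y) * q y - f y * fderiv ℝ q y (A y)) y (A y) =
      secondDerivAlong A f y * q y - f y * secondDerivAlong A q y := by
    intro y
    have h1 := ((hd hf y).mul (hq.differentiable (by simp) y).hasFDerivAt).sub
      ((hf.differentiable (by simp) y).hasFDerivAt.mul (hd hq y))
    rw [HasFDerivAt.fderiv (f := fun y => fderiv ℝ f y (A y) * q y - f y * fderiv ℝ q y (A y)) h1]
    simp [secondDerivAlong]
    ring
  simp_rw [he] at h
  rw [integral_sub] at h
  · linarith
  · exact integrable_of_continuous hσ ((continuous_secondDerivAlong A hf).mul hq.continuous)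
  · exact integrable_of_continuous hσ (hf.continuous.mul (continuous_secondDerivAlong A hq))

end Rotations

/-! ### The angular Laplacian of powers of linear forms -/

section InnerPow

variable {V : Type*} [NormedAddCommGroup V] [InnerProductSpace ℝ V]

theorem fderiv_inner_pow (a : V) (k : ℕ) :
    fderiv ℝ (fun ξ : V => ⟪a, ξ⟫_ℝ ^ k) = fun ξ => (k * ⟪a, ξ⟫_ℝ ^ (k - 1)) • innerSL ℝ a := by
  funext ξ
  have h := ((innerSL ℝ a).hasFDerivAt (x := ξ)).pow k
  simp only [innerSL_apply_apply] at h
  rw [HasFDerivAt.fderiv (f := fun ξ : V => ⟪a, ξ⟫_ℝ ^ k) h]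
  simp [nsmul_eq_mul]

theorem fderiv_fderiv_inner_pow (a : V) (k : ℕ) (ξ h h' : V) :
    fderiv ℝ (fderiv ℝ fun ξ : V => ⟪a, ξ⟫_ℝ ^ k) ξ h h' =
      k * (k - 1) * ⟪a, ξ⟫_ℝ ^ (k - 2) * ⟪a, h⟫_ℝ * ⟪a, h'⟫_ℝ := by
  rw [fderiv_inner_pow]
  have h1 := ((((innerSL ℝ a).hasFDerivAt (x := ξ)).pow (k - 1)).const_mul (k : ℝ)).smul_const
    (innerSL ℝ a)
  simp only [innerSL_apply_apply] at h1
  rw [HasFDerivAt.fderiv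
    (f := fun ξ : V => ((k : ℝ) * ⟪a, ξ⟫_ℝ ^ (k - 1)) • innerSL ℝ a) h1]
  rcases k with _ | k
  · simp
  · simp [nsmul_eq_mul]
    left
    ring

theorem contDiff_inner_pow (a : V) (k : ℕ) : ContDiff ℝ ∞ fun ξ : V => ⟪a, ξ⟫_ℝ ^ k :=
  (innerSL ℝ a).contDiff.pow k

theorem sum_secondDerivAlong_inner_pow {n : ℕ} {c : Fin n → V} (hc : Orthonormal ℝ c) {y : V}
    (hy : ∑ i, ⟪c i, y⟫_ℝ • c i = y) (hy1 : ‖y‖ = 1) (a : V) (k : ℕ) :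
    ∑ i, ∑ j, secondDerivAlong (planeRotation (c i) (c j)) (fun ξ => ⟪a, ξ⟫_ℝ ^ k) y =
      2 * k * (k - 1) * (∑ j, ⟪a, c j⟫_ℝ ^ 2) * ⟪a, y⟫_ℝ ^ (k - 2) -
        2 * (k * (k + n - 2)) * ⟪a, y⟫_ℝ ^ k := by
  have h := sum_planeRotation hc hy hy1 (fderiv ℝ (fderiv ℝ fun ξ : V => ⟪a, ξ⟫_ℝ ^ k) y)
    (fderiv ℝ (fun ξ : V => ⟪a, ξ⟫_ℝ ^ k) y)
  simp only [secondDerivAlong]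
  rw [h]
  simp only [fderiv_fderiv_inner_pow]
  rw [fderiv_inner_pow]
  have e : ∑ j, (k * (k - 1) * ⟪a, y⟫_ℝ ^ (k - 2) * ⟪a, c j⟫_ℝ * ⟪a, c j⟫_ℝ : ℝ) =
      k * (k - 1) * ⟪a, y⟫_ℝ ^ (k - 2) * ∑ j, ⟪a, c j⟫_ℝ ^ 2 := by
    rw [Finset.mul_sum]
    exact Finset.sum_congr rfl fun j _ => by ring
  rw [e]
  simp only [smul_apply, innerSL_apply_apply, smul_eq_mul]
  -- For k = 0, 1 the exponent k - 2 is truncated, but its coefficient k(k-1) vanishes.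
  rcases k with _ | _ | k
  · simp
  · simp
    left
    ring
  · have e1 : k + 1 + 1 - 2 = k := by omega
    have e2 : k + 1 + 1 - 1 = k + 1 := by omega
    rw [e1, e2]
    push_cast
    ring

end InnerPow

/-! ### Geodesic polar coordinates -/

section Polar

variable {V : Type*} [NormedAddCommGroup V] [InnerProductSpace ℝ V]

/-- The point of the unit sphere at distance `r` from `p` in the direction `ξ`. -/
noncomputable def polarPoint (p : V) (r : ℝ) (ξ : V) : V := Real.cos r • p + Real.sin r • ξ

/-- The radial unit vector at `polarPoint p r ξ`. -/
noncomputable def polarDir (p : V) (r : ℝ) (ξ : V) : V := -Real.sin r • p + Real.cos r • ξ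

theorem hasDerivAt_polarPoint (p : V) (r : ℝ) (ξ : V) :
    HasDerivAt (fun s => polarPoint p s ξ) (polarDir p r ξ) r :=
  ((Real.hasDerivAt_cos r).smul_const p).add ((Real.hasDerivAt_sin r).smul_const ξ)

theorem hasDerivAt_polarDir (p : V) (r : ℝ) (ξ : V) :
    HasDerivAt (fun s => polarDir p s ξ) (-polarPoint p r ξ) r := by
  refine (((Real.hasDerivAt_sin r).neg.smul_const p).add
    ((Real.hasDerivAt_cos r).smul_const ξ)).congr_deriv ?_
  simp only [polarPoint, neg_add, neg_smul]

theorem contDiff_polarPoint (p : V) : ContDiff ℝ ∞ fun x : ℝ × V => polarPoint p x.1 x.2 := by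
  have h1 : ContDiff ℝ ∞ fun x : ℝ × V => Real.cos x.1 := Real.contDiff_cos.comp contDiff_fst
  have h2 : ContDiff ℝ ∞ fun x : ℝ × V => Real.sin x.1 := Real.contDiff_sin.comp contDiff_fst
  exact (h1.smul contDiff_const).add (h2.smul contDiff_snd)

theorem contDiff_polarDir (p : V) : ContDiff ℝ ∞ fun x : ℝ × V => polarDir p x.1 x.2 := by
  have h1 : ContDiff ℝ ∞ fun x : ℝ × V => Real.cos x.1 := Real.contDiff_cos.comp contDiff_fst
  have h2 : ContDiff ℝ ∞ fun x : ℝ × V => Real.sin x.1 := Real.contDiff_sin.comp contDiff_fst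
  exact (h2.neg.smul contDiff_const).add (h1.smul contDiff_snd)

theorem direction_eq (p : V) (r : ℝ) (ξ : V) :
    ξ = Real.sin r • polarPoint p r ξ + Real.cos r • polarDir p r ξ := by
  have h := Real.sin_sq_add_cos_sq r
  simp only [polarPoint, polarDir]
  have : Real.sin r • (Real.cos r • p + Real.sin r • ξ) +
      Real.cos r • (-Real.sin r • p + Real.cos r • ξ) =
      (Real.sin r ^ 2 + Real.cos r ^ 2) • ξ := by module
  rw [this, h, one_smul]

/-- The pair (`polarPoint`, `polarDir`) arises from (p, ξ) by a rotation through r in their plane,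
which preserves the trace of B on the pair. -/
theorem bilin_polar (B : V →L[ℝ] V →L[ℝ] ℝ) (p : V) (r : ℝ) (ξ : V) :
    B (polarPoint p r ξ) (polarPoint p r ξ) + B (polarDir p r ξ) (polarDir p r ξ) =
      B p p + B ξ ξ := by
  have h := Real.sin_sq_add_cos_sq r
  simp only [polarPoint, polarDir, map_add, map_smul, add_apply,
    smul_apply, smul_eq_mul]
  linear_combination (B p p + B ξ ξ) * h

theorem fderiv_comp_polarPoint {W : V → ℝ} (hW : ContDiff ℝ ∞ W) (p : V) (r : ℝ) :
    fderiv ℝ (fun ξ => W (polarPoint p r ξ)) =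
      fun ξ => Real.sin r • fderiv ℝ W (polarPoint p r ξ) := by
  funext ξ
  have h1 : HasFDerivAt (fun ξ => polarPoint p r ξ) (Real.sin r • ContinuousLinearMap.id ℝ V) ξ :=
    ((hasFDerivAt_id ξ).const_smul (Real.sin r)).const_add (Real.cos r • p)
  have h2 := (hW.differentiable (by simp) (polarPoint p r ξ)).hasFDerivAt.comp ξ h1
  rw [HasFDerivAt.fderiv (f := fun ξ => W (polarPoint p r ξ)) h2]
  ext v
  simp

theorem fderiv_fderiv_comp_polarPoint {W : V → ℝ} (hW : ContDiff ℝ ∞ W) (p : V) (r : ℝ) (ξ : V) :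
    fderiv ℝ (fderiv ℝ fun ξ => W (polarPoint p r ξ)) ξ =
      Real.sin r ^ 2 • fderiv ℝ (fderiv ℝ W) (polarPoint p r ξ) := by
  rw [fderiv_comp_polarPoint hW]
  have hW1 : ContDiff ℝ ∞ (fderiv ℝ W) := hW.fderiv_right (by simp)
  have h1 : HasFDerivAt (fun ξ => polarPoint p r ξ) (Real.sin r • ContinuousLinearMap.id ℝ V) ξ :=
    ((hasFDerivAt_id ξ).const_smul (Real.sin r)).const_add (Real.cos r • p)
  have h2 := ((hW1.differentiable (by simp) (polarPoint p r ξ)).hasFDerivAt.comp ξ h1).const_smul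
    (Real.sin r)
  rw [HasFDerivAt.fderiv (f := fun ξ => Real.sin r • fderiv ℝ W (polarPoint p r ξ)) h2]
  ext v w
  simp
  ring

theorem contDiff_comp_polarPoint {W : V → ℝ} (hW : ContDiff ℝ ∞ W) (p : V) (r : ℝ) :
    ContDiff ℝ ∞ fun ξ => W (polarPoint p r ξ) :=
  hW.comp ((contDiff_polarPoint p).comp (contDiff_const.prodMk contDiff_id))

theorem laplacian_eq_sum [FiniteDimensional ℝ V] {ι : Type*} [Fintype ι]
    (b : OrthonormalBasis ι ℝ V) (f : V → ℝ) (x : V) :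
    Laplacian.laplacian f x = ∑ i, fderiv ℝ (fderiv ℝ f) x (b i) (b i) := by
  rw [InnerProductSpace.laplacian_eq_iteratedFDeriv_orthonormalBasis f b]
  simp [iteratedFDeriv_two_apply]

/-- The Laplacian in polar coordinates, at a point where the first two radial derivatives (along
rays) vanish: the angular part is expressed through the coordinate plane rotations. -/
theorem sum_secondDerivAlong_comp_polarPoint [FiniteDimensional ℝ V] {n : ℕ}
    (b : OrthonormalBasis (Fin (n + 1)) ℝ V) {W : V → ℝ} (hW : ContDiff ℝ ∞ W) {r : ℝ} {ξ : V}
    (hξ : ‖ξ‖ = 1) (hbξ : ⟪b 0, ξ⟫_ℝ = 0)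
    (h1 : fderiv ℝ W (polarPoint (b 0) r ξ) (polarPoint (b 0) r ξ) = 0)
    (h2 : fderiv ℝ (fderiv ℝ W) (polarPoint (b 0) r ξ) (polarPoint (b 0) r ξ)
      (polarPoint (b 0) r ξ) = 0) :
    ∑ i : Fin n, ∑ j : Fin n, secondDerivAlong (planeRotation (b i.succ) (b j.succ))
      (fun ξ => W (polarPoint (b 0) r ξ)) ξ =
    2 * Real.sin r ^ 2 * (Laplacian.laplacian W (polarPoint (b 0) r ξ) -
      fderiv ℝ (fderiv ℝ W) (polarPoint (b 0) r ξ) (polarDir (b 0) r ξ) (polarDir (b 0) r ξ)) -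
    2 * (n - 1) * Real.sin r * Real.cos r *
      fderiv ℝ W (polarPoint (b 0) r ξ) (polarDir (b 0) r ξ) := by
  have hc : Orthonormal ℝ fun i : Fin n => b i.succ :=
    b.orthonormal.comp _ (Fin.succ_injective n)
  have hy : ∑ i : Fin n, ⟪b i.succ, ξ⟫_ℝ • b i.succ = ξ := by
    have := b.sum_repr' ξ
    rwa [Fin.sum_univ_succ, hbξ, zero_smul, zero_add] at this
  have h := sum_planeRotation hc hy hξ
    (fderiv ℝ (fderiv ℝ fun ξ => W (polarPoint (b 0) r ξ)) ξ)
    (fderiv ℝ (fun ξ => W (polarPoint (b 0) r ξ)) ξ)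
  simp only [secondDerivAlong]
  rw [h, fderiv_fderiv_comp_polarPoint hW, fderiv_comp_polarPoint hW, laplacian_eq_sum b,
    Fin.sum_univ_succ]
  -- In the trace of the Hessian, the entries for p and ξ are traded for the radial direction and
  -- the position vector; the latter entry is zero by `h2`.
  have hB := bilin_polar (fderiv ℝ (fderiv ℝ W) (polarPoint (b 0) r ξ)) (b 0) r ξ
  have hl : fderiv ℝ W (polarPoint (b 0) r ξ) ξ =
      Real.cos r * fderiv ℝ W (polarPoint (b 0) r ξ) (polarDir (b 0) r ξ) := by
    have h3 := congrArg (fderiv ℝ W (polarPoint (b 0) r ξ)) (direction_eq (b 0) r ξ)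
    rw [map_add, map_smul, map_smul, h1] at h3
    simpa using h3
  simp only [smul_apply, smul_eq_mul, hl, ← Finset.mul_sum]
  rw [h2] at hB
  linear_combination 2 * Real.sin r ^ 2 * hB

end Polar

/-! ### Moments over geodesic spheres and their radial equation -/

theorem continuous_radial_second_deriv {V X : Type*} [NormedAddCommGroup V] [NormedSpace ℝ V]
    [TopologicalSpace X] {W : V → ℝ} (hW : ContDiff ℝ ∞ W) {γ τ : X → V} (hγ : Continuous γ)
    (hτ : Continuous τ) :
    Continuous fun x => fderiv ℝ (fderiv ℝ W) (γ x) (τ x) (τ x) - fderiv ℝ W (γ x) (γ x) := by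
  have hW1 : ContDiff ℝ ∞ (fderiv ℝ W) := hW.fderiv_right (by simp)
  have hW2 : Continuous (fderiv ℝ (fderiv ℝ W)) := hW1.continuous_fderiv (by simp)
  have h1 : Continuous fun x => fderiv ℝ (fderiv ℝ W) (γ x) := hW2.comp hγ
  have h2 : Continuous fun x => fderiv ℝ (fderiv ℝ W) (γ x) (τ x) := h1.clm_apply hτ
  have h3 : Continuous fun x => fderiv ℝ W (γ x) := hW1.continuous.comp hγ
  exact (h2.clm_apply hτ).sub (h3.clm_apply hγ)

theorem integral_sub_sub {X : Type*} [MeasurableSpace X] {σ : Measure X} {f g h : X → ℝ}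
    (hf : Integrable f σ) (hg : Integrable g σ) (hh : Integrable h σ) (α β γ : ℝ) :
    ∫ x, (α * f x - β * g x - γ * h x) ∂σ =
      α * ∫ x, f x ∂σ - β * ∫ x, g x ∂σ - γ * ∫ x, h x ∂σ := by
  have hfg : Integrable (fun x => α * f x - β * g x) σ := (hf.const_mul α).sub (hg.const_mul β)
  rw [integral_sub hfg (hh.const_mul γ),
    integral_sub (hf.const_mul α) (hg.const_mul β), integral_const_mul, integral_const_mul,
    integral_const_mul]

theorem two_le_finrank {V : Type*} [NormedAddCommGroup V] [InnerProductSpace ℝ V] {n : ℕ}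
    (hn : 1 ≤ n) (b : OrthonormalBasis (Fin (n + 1)) ℝ V) : 2 ≤ Module.finrank ℝ V := by
  rw [Module.finrank_eq_card_basis b.toBasis, Fintype.card_fin]
  omega

section Moment

variable {V : Type*} [NormedAddCommGroup V] [InnerProductSpace ℝ V]
  [FiniteDimensional ℝ V] [MeasurableSpace V] [BorelSpace V]

/-- The moment of `W` against the `k`-th power of the linear form `a` over the geodesic sphere of
radius `r` about `p`. -/
noncomputable def sphereMoment (p : V) (W : V → ℝ) (a : V) (k : ℕ) (r : ℝ) : ℝ :=
  ∫ ξ, W (polarPoint p r ξ) * ⟪a, ξ⟫_ℝ ^ k ∂equatorMeasure p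

variable {p : V} {W : V → ℝ}

theorem contDiff_sphereMoment (hp : ‖p‖ = 1) (hV : 2 ≤ Module.finrank ℝ V)
    (hW : ContDiff ℝ ∞ W) (a : V) (k : ℕ) : ContDiff ℝ ∞ (sphereMoment p W a k) :=
  contDiff_integral ((ae_equatorMeasure hp hV).mono fun _ h => h.1)
    (Φ := fun x => W (polarPoint p x.1 x.2) * ⟪a, x.2⟫_ℝ ^ k)
    ((hW.comp (contDiff_polarPoint p)).mul ((contDiff_inner_pow a k).comp contDiff_snd))

theorem hasDerivAt_sphereMoment (hp : ‖p‖ = 1) (hV : 2 ≤ Module.finrank ℝ V)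
    (hW : ContDiff ℝ ∞ W) (a : V) (k : ℕ) (r : ℝ) :
    HasDerivAt (sphereMoment p W a k)
      (∫ ξ, fderiv ℝ W (polarPoint p r ξ) (polarDir p r ξ) * ⟪a, ξ⟫_ℝ ^ k ∂equatorMeasure p) r := by
  refine hasDerivAt_integral_of_continuous ((ae_equatorMeasure hp hV).mono fun _ h => h.1)
    (Φ := fun r ξ => W (polarPoint p r ξ) * ⟪a, ξ⟫_ℝ ^ k)
    (Φ' := fun r ξ => fderiv ℝ W (polarPoint p r ξ) (polarDir p r ξ) * ⟪a, ξ⟫_ℝ ^ k) ?_ ?_ ?_ r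
  · exact (hW.continuous.comp (contDiff_polarPoint p).continuous).mul
      ((contDiff_inner_pow a k).continuous.comp continuous_snd)
  · exact (((hW.continuous_fderiv (by simp)).comp (contDiff_polarPoint p).continuous).clm_apply
      (contDiff_polarDir p).continuous).mul
      ((contDiff_inner_pow a k).continuous.comp continuous_snd)
  · intro t ξ
    exact ((hW.differentiable (by simp) _).hasFDerivAt.comp_hasDerivAt t
      (hasDerivAt_polarPoint p t ξ)).mul_const _

theorem hasDerivAt_deriv_sphereMoment (hp : ‖p‖ = 1) (hV : 2 ≤ Module.finrank ℝ V)
    (hW : ContDiff ℝ ∞ W) (a : V) (k : ℕ) (r : ℝ) :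
    HasDerivAt (deriv (sphereMoment p W a k))
      (∫ ξ, (fderiv ℝ (fderiv ℝ W) (polarPoint p r ξ) (polarDir p r ξ) (polarDir p r ξ) -
        fderiv ℝ W (polarPoint p r ξ) (polarPoint p r ξ)) * ⟪a, ξ⟫_ℝ ^ k ∂equatorMeasure p) r := by
  have hW1 : ContDiff ℝ ∞ (fderiv ℝ W) := hW.fderiv_right (by simp)
  have hd : deriv (sphereMoment p W a k) = fun r =>
      ∫ ξ, fderiv ℝ W (polarPoint p r ξ) (polarDir p r ξ) * ⟪a, ξ⟫_ℝ ^ k ∂equatorMeasure p :=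
    funext fun r => (hasDerivAt_sphereMoment hp hV hW a k r).deriv
  rw [hd]
  have hc := (contDiff_polarPoint p).continuous
  have hc' := (contDiff_polarDir p).continuous
  have hq : Continuous fun x : ℝ × V => ⟪a, x.2⟫_ℝ ^ k :=
    (contDiff_inner_pow a k).continuous.comp continuous_snd
  have hΦ : Continuous fun x : ℝ × V =>
      fderiv ℝ W (polarPoint p x.1 x.2) (polarDir p x.1 x.2) * ⟪a, x.2⟫_ℝ ^ k :=
    ((hW1.continuous.comp hc).clm_apply hc').mul hq
  refine hasDerivAt_integral_of_continuous ((ae_equatorMeasure hp hV).mono fun _ h => h.1)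
    (Φ := fun r ξ => fderiv ℝ W (polarPoint p r ξ) (polarDir p r ξ) * ⟪a, ξ⟫_ℝ ^ k)
    (Φ' := fun r ξ => (fderiv ℝ (fderiv ℝ W) (polarPoint p r ξ) (polarDir p r ξ) (polarDir p r ξ) -
        fderiv ℝ W (polarPoint p r ξ) (polarPoint p r ξ)) * ⟪a, ξ⟫_ℝ ^ k) ?_ ?_ ?_ r
  · exact hΦ
  · exact (continuous_radial_second_deriv hW hc hc').mul hq
  · intro t ξ
    have h1 := (hW1.differentiable (by simp) (polarPoint p t ξ)).hasFDerivAt.comp_hasDerivAt t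
      (hasDerivAt_polarPoint p t ξ)
    refine ((h1.clm_apply (hasDerivAt_polarDir p t ξ)).mul_const _).congr_deriv ?_
    rw [map_neg, sub_eq_add_neg]
    rfl

theorem integral_sum_secondDerivAlong_mul {n : ℕ} (hn : 1 ≤ n)
    (b : OrthonormalBasis (Fin (n + 1)) ℝ V) {f q : V → ℝ} (hf : ContDiff ℝ ∞ f)
    (hq : ContDiff ℝ ∞ q) :
    ∫ ξ, (∑ i : Fin n, ∑ j : Fin n,
      secondDerivAlong (planeRotation (b i.succ) (b j.succ)) f ξ) * q ξ ∂equatorMeasure (b 0) =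
    ∫ ξ, f ξ * (∑ i : Fin n, ∑ j : Fin n,
      secondDerivAlong (planeRotation (b i.succ) (b j.succ)) q ξ) ∂equatorMeasure (b 0) := by
  have hp : ‖b 0‖ = 1 := b.orthonormal.1 0
  have hV := two_le_finrank hn b
  have hσ1 : ∀ᵐ ξ ∂equatorMeasure (b 0), ‖ξ‖ = 1 := (ae_equatorMeasure hp hV).mono fun _ h => h.1
  have hA : ∀ i : Fin n, ∀ j : Fin n, planeRotation (b i.succ) (b j.succ) (b 0) = 0 := by
    intro i j
    have h0 : ∀ i : Fin n, ⟪b i.succ, b 0⟫_ℝ = 0 := fun i =>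
      b.orthonormal.2 (Fin.succ_ne_zero i)
    rw [planeRotation_apply, h0, h0, zero_smul, zero_smul, sub_zero]
  simp_rw [Finset.sum_mul, Finset.mul_sum]
  have hi1 : ∀ i j : Fin n, Integrable (fun ξ =>
      secondDerivAlong (planeRotation (b i.succ) (b j.succ)) f ξ * q ξ) (equatorMeasure (b 0)) :=
    fun i j => integrable_of_continuous hσ1
      ((continuous_secondDerivAlong _ hf).mul hq.continuous)
  have hi2 : ∀ i j : Fin n, Integrable (fun ξ => f ξ *
      secondDerivAlong (planeRotation (b i.succ) (b j.succ)) q ξ) (equatorMeasure (b 0)) :=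
    fun i j => integrable_of_continuous hσ1
      (hf.continuous.mul (continuous_secondDerivAlong _ hq))
  rw [integral_finsetSum _ fun i _ => integrable_finsetSum _ fun j _ => hi1 i j,
    integral_finsetSum _ fun i _ => integrable_finsetSum _ fun j _ => hi2 i j]
  refine Finset.sum_congr rfl fun i _ => ?_
  rw [integral_finsetSum _ fun j _ => hi1 i j, integral_finsetSum _ fun j _ => hi2 i j]
  exact Finset.sum_congr rfl fun j _ => integral_secondDerivAlong_mul hp hV
    (planeRotation_skew _ _) (hA i j) hf hq

theorem integral_mul_sum_secondDerivAlong_inner_pow {n : ℕ} (hn : 1 ≤ n)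
    (b : OrthonormalBasis (Fin (n + 1)) ℝ V) (hW : ContDiff ℝ ∞ W) (r : ℝ) (a : V) (k : ℕ) :
    ∫ ξ, W (polarPoint (b 0) r ξ) * (∑ i : Fin n, ∑ j : Fin n,
        secondDerivAlong (planeRotation (b i.succ) (b j.succ))
          (fun ξ => ⟪a, ξ⟫_ℝ ^ k) ξ) ∂equatorMeasure (b 0) =
      2 * k * (k - 1) * (∑ j : Fin n, ⟪a, b j.succ⟫_ℝ ^ 2) * sphereMoment (b 0) W a (k - 2) r -
        2 * (k * (k + n - 2)) * sphereMoment (b 0) W a k r := by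
  have hσ := ae_equatorMeasure (b.orthonormal.1 0) (two_le_finrank hn b)
  have hσ1 : ∀ᵐ ξ ∂equatorMeasure (b 0), ‖ξ‖ = 1 := hσ.mono fun _ h => h.1
  have hc : Orthonormal ℝ fun i : Fin n => b i.succ :=
    b.orthonormal.comp _ (Fin.succ_injective n)
  have hq : ∀ k, Continuous fun ξ => W (polarPoint (b 0) r ξ) * ⟪a, ξ⟫_ℝ ^ k := fun k =>
    (contDiff_comp_polarPoint hW (b 0) r).continuous.mul (contDiff_inner_pow a k).continuous
  rw [sphereMoment, sphereMoment, ← integral_const_mul, ← integral_const_mul, ← integral_sub]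
  · refine integral_congr_ae ?_
    filter_upwards [hσ] with ξ hξ
    have hy : ∑ i : Fin n, ⟪b i.succ, ξ⟫_ℝ • b i.succ = ξ := by
      have := b.sum_repr' ξ
      rwa [Fin.sum_univ_succ, hξ.2, zero_smul, zero_add] at this
    rw [sum_secondDerivAlong_inner_pow hc hy hξ.1]
    ring
  · exact integrable_of_continuous hσ1 (continuous_const.mul (hq _))
  · exact integrable_of_continuous hσ1 (continuous_const.mul (hq _))

/-- The eigenvalue equation replaces the angular part by radial derivatives. Along a great circle
the second derivative of W is its Hessian minus the derivative in the direction of the position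
vector, and the latter vanishes by `h1`. -/
theorem integral_sum_secondDerivAlong_polar_mul {n : ℕ} (hn : 1 ≤ n)
    (b : OrthonormalBasis (Fin (n + 1)) ℝ V) (hW : ContDiff ℝ ∞ W) {m r : ℝ}
    (h1 : ∀ ξ, ‖ξ‖ = 1 → ⟪b 0, ξ⟫_ℝ = 0 →
      fderiv ℝ W (polarPoint (b 0) r ξ) (polarPoint (b 0) r ξ) = 0)
    (h2 : ∀ ξ, ‖ξ‖ = 1 → ⟪b 0, ξ⟫_ℝ = 0 → fderiv ℝ (fderiv ℝ W) (polarPoint (b 0) r ξ)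
      (polarPoint (b 0) r ξ) (polarPoint (b 0) r ξ) = 0)
    (hlap : ∀ ξ, ‖ξ‖ = 1 → ⟪b 0, ξ⟫_ℝ = 0 →
      -Laplacian.laplacian W (polarPoint (b 0) r ξ) = m * W (polarPoint (b 0) r ξ))
    (a : V) (k : ℕ) :
    ∫ ξ, (∑ i : Fin n, ∑ j : Fin n,
      secondDerivAlong (planeRotation (b i.succ) (b j.succ))
        (fun ξ => W (polarPoint (b 0) r ξ)) ξ) * ⟪a, ξ⟫_ℝ ^ k ∂equatorMeasure (b 0) =
      -(2 * Real.sin r ^ 2 * m) * sphereMoment (b 0) W a k r -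
        2 * Real.sin r ^ 2 * deriv (deriv (sphereMoment (b 0) W a k)) r -
        2 * (n - 1) * Real.sin r * Real.cos r * deriv (sphereMoment (b 0) W a k) r := by
  have hp : ‖b 0‖ = 1 := b.orthonormal.1 0
  have hV := two_le_finrank hn b
  have hσ := ae_equatorMeasure hp hV
  have hσ1 : ∀ᵐ ξ ∂equatorMeasure (b 0), ‖ξ‖ = 1 := hσ.mono fun _ h => h.1
  have hW1 : ContDiff ℝ ∞ (fderiv ℝ W) := hW.fderiv_right (by simp)
  have hq := (contDiff_inner_pow a k).continuous
  have hpp : Continuous fun ξ => polarPoint (b 0) r ξ :=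
    continuous_const.add (continuous_const.smul continuous_id)
  have hpd : Continuous fun ξ => polarDir (b 0) r ξ :=
    continuous_const.add (continuous_const.smul continuous_id)
  have hc0 : Continuous fun ξ => W (polarPoint (b 0) r ξ) * ⟪a, ξ⟫_ℝ ^ k :=
    (hW.continuous.comp hpp).mul hq
  have hc1 : Continuous fun ξ =>
      fderiv ℝ W (polarPoint (b 0) r ξ) (polarDir (b 0) r ξ) * ⟪a, ξ⟫_ℝ ^ k :=
    ((hW1.continuous.comp hpp).clm_apply hpd).mul hq
  have hc2 : Continuous fun ξ => (fderiv ℝ (fderiv ℝ W) (polarPoint (b 0) r ξ)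
      (polarDir (b 0) r ξ) (polarDir (b 0) r ξ) -
        fderiv ℝ W (polarPoint (b 0) r ξ) (polarPoint (b 0) r ξ)) * ⟪a, ξ⟫_ℝ ^ k :=
    (continuous_radial_second_deriv hW hpp hpd).mul hq
  rw [(hasDerivAt_sphereMoment hp hV hW a k r).deriv,
    (hasDerivAt_deriv_sphereMoment hp hV hW a k r).deriv, sphereMoment,
    ← integral_sub_sub (integrable_of_continuous hσ1 hc0) (integrable_of_continuous hσ1 hc2)
      (integrable_of_continuous hσ1 hc1)]
  refine integral_congr_ae ?_
  filter_upwards [hσ] with ξ hξ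
  rw [sum_secondDerivAlong_comp_polarPoint b hW hξ.1 hξ.2 (h1 ξ hξ.1 hξ.2) (h2 ξ hξ.1 hξ.2),
    h1 ξ hξ.1 hξ.2]
  linear_combination (-2 * Real.sin r ^ 2 * ⟪a, ξ⟫_ℝ ^ k) * hlap ξ hξ.1 hξ.2

/-- The moments of a solution of `-Δ W = m W` satisfy the radial equation, provided the moments
of lower degree vanish. -/
theorem sphereMoment_ode {n : ℕ} (hn : 1 ≤ n) (b : OrthonormalBasis (Fin (n + 1)) ℝ V)
    (hW : ContDiff ℝ ∞ W) {m r : ℝ}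
    (h1 : ∀ ξ, ‖ξ‖ = 1 → ⟪b 0, ξ⟫_ℝ = 0 →
      fderiv ℝ W (polarPoint (b 0) r ξ) (polarPoint (b 0) r ξ) = 0)
    (h2 : ∀ ξ, ‖ξ‖ = 1 → ⟪b 0, ξ⟫_ℝ = 0 → fderiv ℝ (fderiv ℝ W) (polarPoint (b 0) r ξ)
      (polarPoint (b 0) r ξ) (polarPoint (b 0) r ξ) = 0)
    (hlap : ∀ ξ, ‖ξ‖ = 1 → ⟪b 0, ξ⟫_ℝ = 0 →
      -Laplacian.laplacian W (polarPoint (b 0) r ξ) = m * W (polarPoint (b 0) r ξ))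
    (a : V) (k : ℕ) (hlow : 2 ≤ k → sphereMoment (b 0) W a (k - 2) r = 0) :
    Real.sin r ^ 2 * deriv (deriv (sphereMoment (b 0) W a k)) r +
      (n - 1) * Real.sin r * Real.cos r * deriv (sphereMoment (b 0) W a k) r +
      (m * Real.sin r ^ 2 - k * (k + n - 2)) * sphereMoment (b 0) W a k r = 0 := by
  have hparts := integral_sum_secondDerivAlong_mul hn b (contDiff_comp_polarPoint hW (b 0) r)
    (contDiff_inner_pow a k)
  rw [integral_sum_secondDerivAlong_polar_mul hn b hW h1 h2 hlap a k,
    integral_mul_sum_secondDerivAlong_inner_pow hn b hW] at hparts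
  have hzero : (k : ℝ) * (k - 1) * sphereMoment (b 0) W a (k - 2) r = 0 := by
    rcases k with _ | _ | k
    · simp
    · simp
    · rw [hlow (by omega), mul_zero]
  linear_combination (-1 / 2) * hparts - (∑ j : Fin n, ⟪a, b j.succ⟫_ℝ ^ 2) * hzero

/-- The eigenvalue bound for a function that is, near the ball, constant along rays. -/
theorem muTilde_lt_of_polar {n : ℕ} (hn : 2 ≤ n) (b : OrthonormalBasis (Fin (n + 1)) ℝ V)
    (hW : ContDiff ℝ ∞ W) {m δ : ℝ} (hm : m ≠ 0) (hδ : δ ∈ Ioo 0 (Real.pi / 2))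
    (h1 : ∀ r ∈ Ioo 0 δ, ∀ ξ, ‖ξ‖ = 1 → ⟪b 0, ξ⟫_ℝ = 0 →
      fderiv ℝ W (polarPoint (b 0) r ξ) (polarPoint (b 0) r ξ) = 0)
    (h2 : ∀ r ∈ Ioo 0 δ, ∀ ξ, ‖ξ‖ = 1 → ⟪b 0, ξ⟫_ℝ = 0 →
      fderiv ℝ (fderiv ℝ W) (polarPoint (b 0) r ξ)
        (polarPoint (b 0) r ξ) (polarPoint (b 0) r ξ) = 0)
    (hlap : ∀ r ∈ Ioo 0 δ, ∀ ξ, ‖ξ‖ = 1 → ⟪b 0, ξ⟫_ℝ = 0 →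
      -Laplacian.laplacian W (polarPoint (b 0) r ξ) = m * W (polarPoint (b 0) r ξ))
    (hneu : ∀ ξ, ‖ξ‖ = 1 → ⟪b 0, ξ⟫_ℝ = 0 →
      fderiv ℝ W (polarPoint (b 0) δ ξ) (polarDir (b 0) δ ξ) = 0)
    (hne : ∃ r ∈ Icc 0 δ, ∃ ξ, ‖ξ‖ = 1 ∧ ⟪b 0, ξ⟫_ℝ = 0 ∧ W (polarPoint (b 0) r ξ) ≠ 0) :
    muTilde n δ < m := by
  classical
  have hp : ‖b 0‖ = 1 := b.orthonormal.1 0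
  have hV := two_le_finrank (by omega) b
  have hσ := ae_equatorMeasure hp hV
  have hn2 : (2 : ℝ) ≤ n := by exact_mod_cast hn
  -- Otherwise all moments on each geodesic sphere vanish, and with them W on the ball.
  have hex : ∃ k : ℕ, ∃ a : V, ∃ r ∈ Icc 0 δ, sphereMoment (b 0) W a k r ≠ 0 := by
    by_contra! hall
    obtain ⟨r, hr, ξ, hξ1, hξ2, hξ⟩ := hne
    have hc : Continuous fun ξ => W (polarPoint (b 0) r ξ) :=
      (contDiff_comp_polarPoint hW (b 0) r).continuous
    exact hξ (eq_zero_of_ae_equatorMeasure hc (ae_eq_zero_of_moments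
      (hσ.mono fun _ h => h.1) hc fun a k => hall k a r hr) hξ1 hξ2)
  obtain ⟨a, hne'⟩ := Nat.find_spec hex
  have hmin : ∀ j < Nat.find hex, ∀ r ∈ Icc 0 δ, sphereMoment (b 0) W a j r = 0 := by
    intro j hj r hr
    by_contra h
    exact Nat.find_min hex hj ⟨a, r, hr, h⟩
  set k := Nat.find hex
  have hode : ∀ r ∈ Ioo 0 δ, Real.sin r ^ 2 * deriv (deriv (sphereMoment (b 0) W a k)) r +
      (n - 1) * Real.sin r * Real.cos r * deriv (sphereMoment (b 0) W a k) r +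
      (m * Real.sin r ^ 2 - k * (k + n - 2)) * sphereMoment (b 0) W a k r = 0 := fun r hr =>
    sphereMoment_ode (by omega) b hW (h1 r hr) (h2 r hr) (hlap r hr) a k fun hk =>
      hmin _ (by omega) r ⟨hr.1.le, hr.2.le⟩
  have hg := contDiff_sphereMoment hp hV hW a k
  have hbd : deriv (sphereMoment (b 0) W a k) δ = 0 := by
    rw [(hasDerivAt_sphereMoment hp hV hW a k δ).deriv]
    refine integral_eq_zero_of_ae ?_
    filter_upwards [hσ] with ξ hξ
    rw [hneu ξ hξ.1 hξ.2, zero_mul, Pi.zero_apply]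
  rcases Nat.eq_zero_or_pos k with hk | hk
  · refine muTilde_lt_of_radial_zero hn hm hδ hg (fun r hr => ?_) hbd hne'
    have h := hode r hr
    have hk0 : (k : ℝ) = 0 := by rw [hk, Nat.cast_zero]
    rw [hk0] at h
    linear_combination h
  · have hg1 : ContDiff ℝ ∞ (deriv (sphereMoment (b 0) W a k)) := (contDiff_infty_iff_deriv.1 hg).2
    have hk1 : (1 : ℝ) ≤ k := by exact_mod_cast hk
    refine muTilde_lt_of_radial hn (lam := k * (k + n - 2)) ?_ hδ
      (fun t => (hg.differentiable (by simp) t).hasDerivAt)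
      (fun t => (hg1.differentiable (by simp) t).hasDerivAt)
      (contDiff_infty_iff_deriv.1 hg1).2.continuous hode (Or.inl hbd) hne'
    -- k(k+n-2) - (n-1) = (k-1)(k+n-1).
    nlinarith [mul_nonneg (sub_nonneg.2 hk1) (by linarith : (0 : ℝ) ≤ k + n - 1)]

end Moment

/-! ### Extensions constant along rays -/

section Homogeneous

open scoped Topology Manifold

variable {V : Type*} [NormedAddCommGroup V] [InnerProductSpace ℝ V]

/-- A function smooth near a compact part `K` of the unit sphere has a globally smooth function
that near `K` coincides with its extension constant along rays. -/
theorem exists_contDiff_eventuallyEq_radial [FiniteDimensional ℝ V] {u : V → ℝ} {U K : Set V} (hU : IsOpen U)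
    (hu : ContDiffOn ℝ ∞ u U) (hK : IsClosed K) (hKU : K ⊆ U) (hK1 : ∀ x ∈ K, ‖x‖ = 1) :
    ∃ W : V → ℝ, ContDiff ℝ ∞ W ∧ ∀ x ∈ K, W =ᶠ[𝓝 x] fun y => u (‖y‖⁻¹ • y) := by
  set O : Set V := {0}ᶜ ∩ (fun y : V => ‖y‖⁻¹ • y) ⁻¹' U with hO
  have hcont : ContinuousOn (fun y : V => ‖y‖⁻¹ • y) {0}ᶜ := fun y hy =>
    ((continuous_norm.continuousAt.inv₀ (norm_ne_zero_iff.2 hy)).smul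
      continuousAt_id).continuousWithinAt
  have hOo : IsOpen O := hcont.isOpen_inter_preimage isOpen_compl_singleton hU
  have hKO : K ⊆ O := by
    intro x hx
    refine ⟨?_, ?_⟩
    · rw [mem_compl_singleton_iff, ← norm_ne_zero_iff, hK1 x hx]
      exact one_ne_zero
    · simpa [hK1 x hx] using hKU hx
  obtain ⟨f, hf0, hf1, -⟩ := exists_contMDiffMap_zero_one_nhds_of_isClosed 𝓘(ℝ, V) (n := ⊤)
    hOo.isClosed_compl hK (disjoint_left.2 fun x hx hx' => hx (hKO hx'))
  have hfs : ContDiff ℝ ∞ f := f.contMDiff.contDiff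
  refine ⟨fun y => f y * u (‖y‖⁻¹ • y), ?_, ?_⟩
  · rw [contDiff_iff_contDiffAt]
    intro x
    by_cases hx : x ∈ O
    · refine hfs.contDiffAt.mul ?_
      have h1 : ContDiffAt ℝ ∞ u (‖x‖⁻¹ • x) := hu.contDiffAt (hU.mem_nhds hx.2)
      have h2 : ContDiffAt ℝ ∞ (fun y : V => ‖y‖⁻¹ • y) x :=
        ((contDiffAt_norm ℝ hx.1).inv (norm_ne_zero_iff.2 hx.1)).smul contDiffAt_id
      exact ContDiffAt.comp (f := fun y : V => ‖y‖⁻¹ • y) x h1 h2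
    · refine (contDiffAt_const (c := (0 : ℝ))).congr_of_eventuallyEq ?_
      filter_upwards [hf0.filter_mono (nhds_le_nhdsSet hx)] with y hy
      rw [hy, zero_mul]
  · intro x hx
    filter_upwards [hf1.filter_mono (nhds_le_nhdsSet hx)] with y hy
    rw [hy, one_mul]

theorem fderiv_radial_eq_zero {W u : V → ℝ} (hW : ContDiff ℝ ∞ W) {x : V}
    (h : W =ᶠ[𝓝 x] fun y => u (‖y‖⁻¹ • y)) : fderiv ℝ W x x = 0 := by
  have hline : HasDerivAt (fun t : ℝ => t • x) x 1 := by
    simpa using (hasDerivAt_id (1 : ℝ)).smul_const x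
  have h1 : HasDerivAt (fun t : ℝ => W (t • x)) (fderiv ℝ W x x) 1 := by
    have h2 : HasFDerivAt W (fderiv ℝ W x) ((1 : ℝ) • x) := by
      rw [one_smul]
      exact (hW.differentiable (by simp) x).hasFDerivAt
    exact h2.comp_hasDerivAt 1 hline
  have h3 : (fun t : ℝ => W (t • x)) =ᶠ[𝓝 1] fun _ => u (‖x‖⁻¹ • x) := by
    have hc : Filter.Tendsto (fun t : ℝ => t • x) (𝓝 1) (𝓝 x) := by
      simpa using hline.continuousAt.tendsto
    filter_upwards [hc.eventually h, lt_mem_nhds one_pos] with t ht ht0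
    rw [ht, norm_smul, Real.norm_of_nonneg ht0.le, mul_inv, smul_smul, mul_right_comm,
      inv_mul_cancel₀ ht0.ne', one_mul]
  exact h1.unique ((hasDerivAt_const 1 _).congr_of_eventuallyEq h3)

/-- Near x the identity DW(y)y = 0 holds; differentiating it in the direction x gives D²W(x)(x, x) +
DW(x)x = 0. -/
theorem fderiv_fderiv_radial_eq_zero {W u : V → ℝ} (hW : ContDiff ℝ ∞ W) {x : V}
    (h : W =ᶠ[𝓝 x] fun y => u (‖y‖⁻¹ • y)) : fderiv ℝ (fderiv ℝ W) x x x = 0 := by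
  have hW1 : ContDiff ℝ ∞ (fderiv ℝ W) := hW.fderiv_right (by simp)
  have h1 := (hW1.differentiable (by simp) x).hasFDerivAt.clm_apply (hasFDerivAt_id x)
  have h2 : (fun y => fderiv ℝ W y (id y)) =ᶠ[𝓝 x] fun _ => (0 : ℝ) := by
    filter_upwards [h.eventuallyEq_nhds] with y hy using fderiv_radial_eq_zero hW hy
  have h3 := h1.unique ((hasFDerivAt_const (0 : ℝ) x).congr_of_eventuallyEq h2)
  have h4 := DFunLike.congr_fun h3 x
  simpa [fderiv_radial_eq_zero hW h] using h4

end Homogeneous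

/-! ### The eigenvalue bound on the geodesic ball -/

section Ball

open scoped Topology

theorem inner_polarPoint {V : Type*} [NormedAddCommGroup V] [InnerProductSpace ℝ V] {p ξ : V}
    (hp : ‖p‖ = 1) (hξ : ⟪p, ξ⟫_ℝ = 0) (r : ℝ) : ⟪p, polarPoint p r ξ⟫_ℝ = Real.cos r := by
  rw [polarPoint, inner_add_right, real_inner_smul_right, real_inner_smul_right, hξ,
    real_inner_self_eq_norm_sq, hp]
  ring

theorem norm_polarPoint {V : Type*} [NormedAddCommGroup V] [InnerProductSpace ℝ V] {p ξ : V}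
    (hp : ‖p‖ = 1) (hξ1 : ‖ξ‖ = 1) (hξ : ⟪p, ξ⟫_ℝ = 0) (r : ℝ) : ‖polarPoint p r ξ‖ = 1 := by
  have h : ‖polarPoint p r ξ‖ ^ 2 = 1 := by
    rw [polarPoint, norm_add_sq_real, norm_smul, norm_smul, real_inner_smul_left,
      real_inner_smul_right, hξ, hp, hξ1, Real.norm_eq_abs, Real.norm_eq_abs, mul_one, mul_one,
      sq_abs, sq_abs]
    linarith [Real.sin_sq_add_cos_sq r]
  exact (pow_eq_one_iff_of_nonneg (norm_nonneg _) two_ne_zero).1 h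

theorem angle_polarPoint {V : Type*} [NormedAddCommGroup V] [InnerProductSpace ℝ V] {p ξ : V}
    (hp : ‖p‖ = 1) (hξ1 : ‖ξ‖ = 1) (hξ : ⟪p, ξ⟫_ℝ = 0) {r : ℝ} (h0 : 0 ≤ r) (h1 : r ≤ Real.pi) :
    InnerProductGeometry.angle p (polarPoint p r ξ) = r := by
  rw [InnerProductGeometry.angle, inner_polarPoint hp hξ, norm_polarPoint hp hξ1 hξ, hp, mul_one,
    div_one, Real.arccos_cos h0 h1]

/-- Every point of the unit sphere has polar coordinates. -/
theorem exists_polarPoint_eq {V : Type*} [NormedAddCommGroup V] [InnerProductSpace ℝ V] {p x e : V}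
    (hp : ‖p‖ = 1) (hx : ‖x‖ = 1) (he1 : ‖e‖ = 1) (he : ⟪p, e⟫_ℝ = 0) :
    ∃ ξ, ‖ξ‖ = 1 ∧ ⟪p, ξ⟫_ℝ = 0 ∧ polarPoint p (InnerProductGeometry.angle p x) ξ = x := by
  set r := InnerProductGeometry.angle p x with hr
  have hcos : Real.cos r = ⟪p, x⟫_ℝ := by
    rw [hr, InnerProductGeometry.cos_angle, hp, hx, mul_one, div_one]
  set z := x - Real.cos r • p with hz
  have hpz : ⟪p, z⟫_ℝ = 0 := by
    rw [hz, inner_sub_right, real_inner_smul_right, real_inner_self_eq_norm_sq, hp, hcos]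
    ring
  have hsin : 0 ≤ Real.sin r := Real.sin_nonneg_of_nonneg_of_le_pi
    (InnerProductGeometry.angle_nonneg p x) (InnerProductGeometry.angle_le_pi p x)
  have hnz : ‖z‖ = Real.sin r := by
    have h : ‖z‖ ^ 2 = Real.sin r ^ 2 := by
      rw [hz, norm_sub_sq_real, norm_smul, real_inner_smul_right, real_inner_comm, ← hcos, hx, hp,
        Real.norm_eq_abs, mul_one, sq_abs]
      linarith [Real.sin_sq_add_cos_sq r]
    exact (sq_eq_sq₀ (norm_nonneg z) hsin).1 h
  by_cases h0 : Real.sin r = 0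
  · refine ⟨e, he1, he, ?_⟩
    rw [h0, norm_eq_zero, hz, sub_eq_zero] at hnz
    rw [polarPoint, h0, zero_smul, add_zero, ← hnz]
  · refine ⟨(Real.sin r)⁻¹ • z, ?_, ?_, ?_⟩
    · rw [norm_smul, hnz, norm_inv, Real.norm_of_nonneg hsin, inv_mul_cancel₀ h0]
    · rw [real_inner_smul_right, hpz, mul_zero]
    · rw [polarPoint, smul_smul, mul_inv_cancel₀ h0, one_smul, hz]
      abel

/-- Every nonzero Neumann eigenvalue of a geodesic ball of radius less than `π / 2` is larger
than `muTilde`. -/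
theorem muTilde_lt_of_isNeumannEigenvalue {n : ℕ} (hn : 2 ≤ n)
    (p : Metric.sphere (0 : Ambient n) 1) {δ m : ℝ} (hδ : δ ∈ Ioo 0 (Real.pi / 2)) (hm : m ≠ 0)
    (h : IsNeumannEigenvalue p δ m) : muTilde n δ < m := by
  obtain ⟨u, ⟨U, hU, hBU, hu⟩, ⟨x₀, hx₀, hux₀⟩, hlap, hneu⟩ := h
  have hpi := Real.pi_pos
  have hp : ‖(p : Ambient n)‖ = 1 := mem_sphere_zero_iff_norm.1 p.2
  obtain ⟨hs, hc, -⟩ := sin_pos_cos_mem_Ioo hδ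
  obtain ⟨b, hb⟩ := Orthonormal.exists_orthonormalBasis_extension_of_card_eq (𝕜 := ℝ)
    (ι := Fin (n + 1)) (by simp) (v := fun _ => (p : Ambient n)) (s := {0})
    ⟨fun _ => hp, fun i j hij => absurd (Subsingleton.elim i j) hij⟩
  have hb0 : b 0 = p := hb 0 rfl
  set K : Set (Ambient n) := {x | ‖x‖ = 1 ∧ Real.cos δ ≤ ⟪(p : Ambient n), x⟫_ℝ} with hKdef
  have hK : IsClosed K := by
    have h1 : IsClosed {x : Ambient n | ‖x‖ = 1} := isClosed_eq continuous_norm continuous_const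
    have h2 : IsClosed {x : Ambient n | Real.cos δ ≤ ⟪(p : Ambient n), x⟫_ℝ} :=
      isClosed_le continuous_const (by fun_prop)
    exact h1.inter h2
  have hKB : K ⊆ geodesicBall p δ := by
    intro x hx
    refine ⟨mem_sphere_zero_iff_norm.2 hx.1, ?_⟩
    rw [InnerProductGeometry.angle, hp, hx.1, mul_one, div_one]
    calc Real.arccos ⟪(p : Ambient n), x⟫_ℝ ≤ Real.arccos (Real.cos δ) := Real.arccos_le_arccos hx.2
      _ = δ := Real.arccos_cos hδ.1.le (by linarith [hδ.2])
  obtain ⟨W, hW, hWK⟩ := exists_contDiff_eventuallyEq_radial hU hu hK (hKB.trans hBU)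
    fun x hx => hx.1
  have hmem : ∀ r ∈ Icc 0 δ, ∀ ξ, ‖ξ‖ = 1 → ⟪(p : Ambient n), ξ⟫_ℝ = 0 →
      polarPoint (p : Ambient n) r ξ ∈ K := by
    intro r hr ξ hξ1 hξ
    refine ⟨norm_polarPoint hp hξ1 hξ r, ?_⟩
    rw [inner_polarPoint hp hξ]
    exact Real.cos_le_cos_of_nonneg_of_le_pi hr.1 (by linarith [hδ.2]) hr.2
  have hWu : ∀ x ∈ K, W x = u x := by
    intro x hx
    rw [(hWK x hx).eq_of_nhds, hx.1, inv_one, one_smul]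
  have hangle : ∀ r ∈ Icc 0 δ, ∀ ξ, ‖ξ‖ = 1 → ⟪(p : Ambient n), ξ⟫_ℝ = 0 →
      InnerProductGeometry.angle (p : Ambient n) (polarPoint p r ξ) = r := fun r hr ξ hξ1 hξ =>
    angle_polarPoint hp hξ1 hξ hr.1 (by linarith [hr.2, hδ.2])
  refine muTilde_lt_of_polar hn b hW hm hδ ?_ ?_ ?_ ?_ ?_
  all_goals rw [hb0]
  · exact fun r hr ξ hξ1 hξ =>
      fderiv_radial_eq_zero hW (hWK _ (hmem r ⟨hr.1.le, hr.2.le⟩ ξ hξ1 hξ))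
  · exact fun r hr ξ hξ1 hξ =>
      fderiv_fderiv_radial_eq_zero hW (hWK _ (hmem r ⟨hr.1.le, hr.2.le⟩ ξ hξ1 hξ))
  · intro r hr ξ hξ1 hξ
    have hr' : r ∈ Icc 0 δ := ⟨hr.1.le, hr.2.le⟩
    have hxK := hmem r hr' ξ hξ1 hξ
    rw [hWu _ hxK, ← hlap _ (hKB hxK).1 (by rw [hangle r hr' ξ hξ1 hξ]; exact hr.2),
      sphereLaplacian, (InnerProductSpace.laplacian_congr_nhds (hWK _ hxK)).eq_of_nhds]
  · intro ξ hξ1 hξ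
    have hδ' : δ ∈ Icc 0 δ := ⟨hδ.1.le, le_rfl⟩
    have hxK := hmem δ hδ' ξ hξ1 hξ
    have h1 := hneu _ (hKB hxK).1 (hangle δ hδ' ξ hξ1 hξ)
    have hdir : outwardNormal p δ (polarPoint (p : Ambient n) δ ξ) = polarDir (p : Ambient n) δ ξ := by
      have e : Real.cos δ • polarPoint (p : Ambient n) δ ξ - (p : Ambient n) =
          Real.sin δ • polarDir (p : Ambient n) δ ξ := by
        have hsc : Real.cos δ ^ 2 = 1 - Real.sin δ ^ 2 := Real.cos_sq' δ
        have e2 : Real.cos δ • polarPoint (p : Ambient n) δ ξ - (p : Ambient n) =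
            (Real.cos δ ^ 2 - 1) • (p : Ambient n) + (Real.cos δ * Real.sin δ) • ξ := by
          rw [polarPoint]
          module
        rw [e2, hsc, polarDir]
        module
      rw [outwardNormal, e, smul_smul, inv_mul_cancel₀ hs.ne', one_smul]
    rw [hdir] at h1
    -- W and u need agree only on the sphere near the point, so their normal derivatives are
    -- compared along the great circle, which stays in the sphere.
    have hcurve := hasDerivAt_polarPoint (p : Ambient n) δ ξ
    have hud : HasDerivAt (fun r => u (polarPoint (p : Ambient n) r ξ)) 0 δ := by
      rw [← h1]
      exact ((hu.contDiffAt (hU.mem_nhds (hBU (hKB hxK)))).differentiableAt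
        (by simp)).hasFDerivAt.comp_hasDerivAt δ hcurve
    have hWd : HasDerivAt (fun r => W (polarPoint (p : Ambient n) r ξ))
        (fderiv ℝ W (polarPoint (p : Ambient n) δ ξ) (polarDir (p : Ambient n) δ ξ)) δ :=
      (hW.differentiable (by simp) _).hasFDerivAt.comp_hasDerivAt δ hcurve
    refine hWd.unique (hud.congr_of_eventuallyEq ?_)
    filter_upwards [hcurve.continuousAt.tendsto.eventually (hWK _ hxK)] with r hr
    rw [hr, norm_polarPoint hp hξ1 hξ, inv_one, one_smul]
  -- Polar coordinates of x₀ need an arbitrary equatorial direction in case x₀ = p.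
  · have he1 : ‖b 1‖ = 1 := b.orthonormal.1 1
    have he : ⟪(p : Ambient n), b 1⟫_ℝ = 0 := by
      rw [← hb0]
      exact b.orthonormal.2 (by simp [Fin.ext_iff]; omega)
    obtain ⟨ξ, hξ1, hξ, hx⟩ := exists_polarPoint_eq hp
      (mem_sphere_zero_iff_norm.1 hx₀.1) he1 he
    have hr : InnerProductGeometry.angle (p : Ambient n) x₀ ∈ Icc 0 δ :=
      ⟨InnerProductGeometry.angle_nonneg _ _, hx₀.2⟩
    refine ⟨_, hr, ξ, hξ1, hξ, ?_⟩
    rw [hWu _ (hmem _ hr ξ hξ1 hξ), hx]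
    exact hux₀

theorem neumannMu_eq_zero_or_lt {n : ℕ} (hn : 2 ≤ n) (p : Metric.sphere (0 : Ambient n) 1)
    {δ : ℝ} (hδ : δ ∈ Ioo 0 (Real.pi / 2)) :
    neumannMu p δ = 0 ∨ muTilde n δ < neumannMu p δ := by
  by_cases h : ∃ m, IsFirstNonzeroNeumannEigenvalue p δ m
  · obtain ⟨m, hm⟩ := h
    rw [neumannMu_eq hm]
    exact Or.inr (muTilde_lt_of_isNeumannEigenvalue hn p hδ hm.1.1 hm.1.2)
  · exact Or.inl (dif_neg h)

end Ball

end SphereBall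

theorem proposition2p4 (n : ℕ) (hn : 2 ≤ n)
    (p : Metric.sphere (0 : SphereBall.Ambient n) 1) :
    (∃! d : ℝ, d ∈ Set.Ioo 0 (Real.pi / 2) ∧
      SphereBall.thresholdFun n (SphereBall.muTilde n) d = 0) ∧
    (∃! κ : ℝ, κ ∈ Set.Ioo (0 : ℝ) 1 ∧ SphereBall.quartic n κ = 0) ∧
    ∀ δ₀ ∈ Set.Ioo 0 (Real.pi / 2),
      SphereBall.thresholdFun n (SphereBall.neumannMu p) δ₀ = 0 →
        (∀ d ∈ Set.Ioo 0 (Real.pi / 2),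
          SphereBall.thresholdFun n (SphereBall.muTilde n) d = 0 → d < δ₀) ∧
        (∀ κ ∈ Set.Ioo (0 : ℝ) 1, SphereBall.quartic n κ = 0 → Real.cos δ₀ < κ) ∧
        Real.cos δ₀ ^ 2 < (7 * n - 1) / (2 * n ^ 2 + 5 * n - 1) := by
  refine ⟨SphereBall.existsUnique_thresholdFun_muTilde hn, SphereBall.existsUnique_quartic hn,
    fun δ₀ hδ₀ h0 => ?_⟩
  have hneg := SphereBall.thresholdFun_muTilde_neg hn hδ₀
    (SphereBall.neumannMu_eq_zero_or_lt hn p hδ₀) h0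
  have hq := SphereBall.quartic_cos_neg hn hδ₀ hneg
  have hc := (SphereBall.sin_pos_cos_mem_Ioo hδ₀).2.1
  refine ⟨fun d hd hd0 => ?_, fun κ hκ hκ0 => SphereBall.lt_of_quartic_neg hn hc hκ.1 hq hκ0,
    SphereBall.sq_lt_of_quartic_neg hn hc hq⟩
  refine lt_of_le_of_ne (SphereBall.le_of_thresholdFun_muTilde hn hd hδ₀ hd0 hneg.le) ?_
  rintro rfl
  exact hneg.ne hd0
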